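/- Let $\mathrm{Cat}_{\mathrm{pce}}$ be the 2-category whose objects are the categories admitting pullbacks and finite coproducts, whose 1-morphisms are the functors preserving pullbacks, finite coproducts and epimorphisms, and whose 2-morphisms are all natural transformations. For a finite groupoid $\mathcal{G}$ (finitely many objects and finitely many morphisms) let $\mathrm{Fin}_{\mathcal{G}}=\mathrm{Fun}(\mathcal{G},\mathrm{Fin})$ be the category of functors from $\mathcal{G}$ to finite sets; it is an object of $\mathrm{Cat}_{\mathrm{pce}}$. A functor $F:\mathcal{K}\to\mathcal{G}$ of groupoids is a discrete fibration if for every morphism $f:x\to y$ of $\mathcal{G}$ and every object $x'$ of $\mathcal{K}$ with $F(x')=x$ there is a unique morphism of $\mathcal{K}$ with source $x'$ that $F$ sends to $f$. Let $\mathrm{Burn}_{\mathrm{glo}}^{\mathrm{eff}}$ be the global effective Burnside 2-category: its objects are finite groupoids; a 1-morphism from $\mathcal{G}$ to $\mathcal{H}$ is a span $\mathcal{G}\xleftarrow{p}\mathcal{K}\xrightarrow{q}\mathcal{H}$ of finite groupoids with $p$ a discrete fibration; a 2-morphism from $(\mathcal{K},p,q)$ to $(\mathcal{K}',p',q')$ is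 a functor $f:\mathcal{K}\to\mathcal{K}'$ with $p'f=p$ together with a natural isomorphism $q\cong q'f$; composition of spans is by pullback. **Theorem.** The full sub-2-category of $\mathrm{Cat}_{\mathrm{pce}}$ spanned by the categories $\mathrm{Fin}_{\mathcal{G}}$, as $\mathcal{G}$ ranges over finite groupoids, is equivalent (as a bicategory) to $(\mathrm{Burn}_{\mathrm{glo}}^{\mathrm{eff}})^{\mathrm{op}}$, where $(-)^{\mathrm{op}}$ reverses 1-morphisms only. The same holds for the underlying $(2,1)$-categories, in which only the invertible 2-morphisms are kept on both sides. Here two bicategories $\mathcal A,\mathcal B$ are called equivalent if there is a pseudofunctor $\mathcal A\to\mathcal B$ that is an equivalence on all hom-categories and such that every object of $\mathcal B$ is equivalent in $\mathcal B$ to an object in its image. -/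

import Mathlib

open CategoryTheory CategoryTheory.Limits Opposite

-- With this instance active, `x ⟶ y` in a category elaborates through reflexive quivers.
attribute [-instance] CategoryTheory.catToReflQuiver

universe u v w

section Biequivalence

universe w₁ w₂ v₁ v₂ u₁ u₂

/-- A pseudofunctor is a biequivalence (an equivalence of 2-categories) if it is an equivalence of
categories on all hom-categories, and every object of the target is equivalent, inside the target
bicategory, to an object in the image. -/
structure IsBiequivalence {A : Type u₁} [Bicategory.{w₁, v₁} A] {B : Type u₂}
    [Bicategory.{w₂, v₂} B] (F : Pseudofunctor A B) : Prop where
  isEquivalence_mapFunctor : ∀ a a' : A, (F.mapFunctor a a').IsEquivalence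
  essSurj : ∀ b : B, ∃ a : A, Nonempty (Bicategory.Equivalence (F.obj a) b)

/-- Two bicategories are equivalent if there is a biequivalence between them. -/
def AreBiequivalent (A : Type u₁) [Bicategory.{w₁, v₁} A] (B : Type u₂)
    [Bicategory.{w₂, v₂} B] : Prop :=
  ∃ F : Pseudofunctor A B, IsBiequivalence F

end Biequivalence

/-! ### The 2-category of categories with pullbacks and finite coproducts -/

set_option linter.checkUnivs false in
/-- A category which admits pullbacks and finite coproducts. -/
structure CatPCE where
  /-- the underlying type of objects -/
  carrier : Type w
  [category : Category.{v} carrier]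
  [hasPullbacks : HasPullbacks carrier]
  [hasFiniteCoproducts : HasFiniteCoproducts carrier]

namespace CatPCE

attribute [instance] category hasPullbacks hasFiniteCoproducts

/-- The property of a functor of preserving pullbacks, finite coproducts and epimorphisms. -/
def IsPCE (C D : CatPCE.{v, w}) : ObjectProperty (C.carrier ⥤ D.carrier) := fun F =>
  PreservesLimitsOfShape WalkingCospan F ∧ PreservesFiniteCoproducts F ∧ F.PreservesEpimorphisms

/-- `Fun_pce(C, D)`: the full subcategory of the category of functors `C ⥤ D` on those functors
which preserve pullbacks, finite coproducts and epimorphisms. -/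
abbrev FunPCE (C D : CatPCE.{v, w}) : Type _ := (IsPCE C D).FullSubcategory

theorem isPCE_id (C : CatPCE.{v, w}) : IsPCE C C (𝟭 C.carrier) :=
  ⟨inferInstance, ⟨fun _ => inferInstance⟩, inferInstance⟩

theorem isPCE_comp {C D E : CatPCE.{v, w}} {F : C.carrier ⥤ D.carrier} {G : D.carrier ⥤ E.carrier}
    (hF : IsPCE C D F) (hG : IsPCE D E G) : IsPCE C E (F ⋙ G) := by
  obtain ⟨h₁, h₂, h₃⟩ := hF
  obtain ⟨h₁', h₂', h₃'⟩ := hG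
  exact ⟨inferInstance, inferInstance, inferInstance⟩

instance : CategoryStruct.{max v w} CatPCE.{v, w} where
  Hom C D := FunPCE C D
  id C := ⟨𝟭 C.carrier, isPCE_id C⟩
  comp F G := ⟨F.obj ⋙ G.obj, isPCE_comp F.property G.property⟩

instance homCategory (C D : CatPCE.{v, w}) : Category (C ⟶ D) :=
  inferInstanceAs (Category (FunPCE C D))

/-- The natural transformation underlying a 2-morphism. -/
abbrev nat {C D : CatPCE.{v, w}} {F G : C ⟶ D} (η : F ⟶ G) : F.obj ⟶ G.obj :=
  InducedCategory.Hom.hom η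

/-- The 2-morphism given by a natural transformation. -/
abbrev ofNat {C D : CatPCE.{v, w}} {F G : C ⟶ D} (η : F.obj ⟶ G.obj) : F ⟶ G :=
  ObjectProperty.homMk (P := IsPCE C D) (X := F) (Y := G) η

/-- The invertible 2-morphism given by a natural isomorphism. -/
abbrev ofNatIso {C D : CatPCE.{v, w}} {F G : C ⟶ D} (e : F.obj ≅ G.obj) : F ≅ G where
  hom := ofNat e.hom
  inv := ofNat e.inv
  hom_inv_id := ObjectProperty.hom_ext _ e.hom_inv_id
  inv_hom_id := ObjectProperty.hom_ext _ e.inv_hom_id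

@[ext] theorem hom₂_ext {C D : CatPCE.{v, w}} {F G : C ⟶ D} {η θ : F ⟶ G}
    (h : ∀ X, (nat η).app X = (nat θ).app X) : η = θ :=
  ObjectProperty.hom_ext _ (NatTrans.ext (funext h))

@[simp] theorem nat_id {C D : CatPCE.{v, w}} (F : C ⟶ D) : nat (𝟙 F) = 𝟙 F.obj := rfl

@[simp] theorem nat_comp {C D : CatPCE.{v, w}} {F G H : C ⟶ D} (η : F ⟶ G) (θ : G ⟶ H) :
    nat (η ≫ θ) = nat η ≫ nat θ := rfl

@[simp] theorem obj_id (C : CatPCE.{v, w}) :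
    ObjectProperty.FullSubcategory.obj (P := IsPCE C C) (𝟙 C) = 𝟭 C.carrier := rfl

@[simp] theorem obj_comp {C D E : CatPCE.{v, w}} (F : C ⟶ D) (G : D ⟶ E) :
    ObjectProperty.FullSubcategory.obj (P := IsPCE C E) (F ≫ G) = F.obj ⋙ G.obj := rfl

/-- The 2-category `Cat_pce` of categories which admit pullbacks and finite coproducts; the
1-morphisms are the functors which preserve pullbacks, finite coproducts and epimorphisms, the
2-morphisms are all natural transformations between them. Its maximal sub-(2,1)-category, in
which only the natural isomorphisms are kept, is `Bicategory.Pith CatPCE`. -/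
instance : Bicategory.{max v w} CatPCE.{v, w} where
  homCategory := homCategory
  whiskerLeft {_ _ _} F {G H} η := ofNat (F := F ≫ G) (G := F ≫ H) (Functor.whiskerLeft F.obj (nat η))
  whiskerRight {_ _ _ F G} η H :=
    ofNat (F := F ≫ H) (G := G ≫ H) (Functor.whiskerRight (nat η) H.obj)
  associator F G H :=
    ofNatIso (F := (F ≫ G) ≫ H) (G := F ≫ G ≫ H) (Functor.associator F.obj G.obj H.obj)
  leftUnitor F := ofNatIso (F := 𝟙 _ ≫ F) (G := F) F.obj.leftUnitor
  rightUnitor F := ofNatIso (F := F ≫ 𝟙 _) (G := F) F.obj.rightUnitor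
end CatPCE

/-! ### Finite groupoids and discrete fibrations -/

/-- A finite groupoid: a groupoid with finitely many objects and finitely many morphisms. -/
structure FinGrpd where
  /-- the type of objects -/
  carrier : Type u
  [groupoid : Groupoid.{u} carrier]
  [finite : Finite carrier]
  [finite_hom : ∀ x y : carrier, Finite (x ⟶ y)]

attribute [instance] FinGrpd.groupoid FinGrpd.finite FinGrpd.finite_hom

/-- `Fin_𝒢 = Fun(𝒢, Fin)`, the category of functors from the finite groupoid `𝒢` to the category
of finite sets, as an object of `Cat_pce`. -/
noncomputable def FinGrpd.finCat (𝒢 : FinGrpd.{u}) : CatPCE.{u, u + 1} where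
  carrier := 𝒢.carrier ⥤ FintypeCat.{u}

/-- A functor between groupoids is a discrete fibration if for each morphism `f : x ⟶ y` of the
target and each lift `x'` of `x`, there is a unique lift of `f` to a morphism `x' ⟶ y'`. -/
def IsDiscreteFibration {H G : Type*} [Groupoid H] [Groupoid G] (F : H ⥤ G) : Prop :=
  ∀ (x' : H) (y : G) (f : F.obj x' ⟶ y),
    ∃! φ : Σ y' : H, x' ⟶ y', ∃ h : F.obj φ.1 = y, F.map φ.2 ≫ eqToHom h = f

namespace IsDiscreteFibration

variable {H G K : Type*} [Groupoid H] [Groupoid G] [Groupoid K]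

theorem id : IsDiscreteFibration (𝟭 G) := by
  intro x y f
  refine ⟨⟨y, f⟩, ⟨rfl, by simp⟩, ?_⟩
  rintro ⟨y', g⟩ ⟨h, hg⟩
  dsimp at h hg
  subst h
  simpa using hg

theorem comp {F : H ⥤ G} {F' : G ⥤ K} (hF : IsDiscreteFibration F) (hF' : IsDiscreteFibration F') :
    IsDiscreteFibration (F ⋙ F') := by
  intro x y f
  obtain ⟨⟨y₁, g⟩, ⟨h, hg⟩, hu⟩ := hF' (F.obj x) y f
  obtain ⟨⟨y₂, k⟩, ⟨h', hk⟩, hu'⟩ := hF x y₁ g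
  dsimp at h hg h' hk
  subst h h'
  refine ⟨⟨y₂, k⟩, ⟨rfl, by
    have := congrArg F'.map hk
    simp only [eqToHom_refl, Category.comp_id] at this hg
    simp [this, hg]⟩, ?_⟩
  rintro ⟨y₃, l⟩ ⟨e, hl⟩
  have := hu ⟨F.obj y₃, F.map l⟩ ⟨e, hl⟩
  apply hu'
  simp only [Sigma.mk.injEq] at this
  exact ⟨this.1, by rw [← heq_iff_eq]; exact (comp_eqToHom_heq _ _).trans this.2⟩

theorem faithful {F : H ⥤ G} (hF : IsDiscreteFibration F) {x y z : H} (g : x ⟶ y) (g' : x ⟶ z) (h : F.obj y = F.obj z)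
    (hg : F.map g ≫ eqToHom h = F.map g') : ∃ e : y = z, g ≫ eqToHom e = g' := by
  have := (hF x _ (F.map g')).unique (y₁ := ⟨y, g⟩) (y₂ := ⟨z, g'⟩) ⟨h, hg⟩ ⟨rfl, by simp⟩
  cases this
  exact ⟨rfl, by simp⟩

variable {F : H ⥤ G} (hF : IsDiscreteFibration F)

/-- The endpoint of the unique lift of a morphism along a discrete fibration. -/
noncomputable def liftObj (x' : H) {y : G} (f : F.obj x' ⟶ y) : H := (hF x' y f).choose.1

/-- The unique lift of a morphism along a discrete fibration. -/
noncomputable def lift (x' : H) {y : G} (f : F.obj x' ⟶ y) : x' ⟶ hF.liftObj x' f :=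
  (hF x' y f).choose.2

theorem obj_liftObj (x' : H) {y : G} (f : F.obj x' ⟶ y) : F.obj (hF.liftObj x' f) = y :=
  (hF x' y f).choose_spec.1.choose

theorem map_lift (x' : H) {y : G} (f : F.obj x' ⟶ y) :
    F.map (hF.lift x' f) = f ≫ eqToHom (hF.obj_liftObj x' f).symm := by
  have := (hF x' y f).choose_spec.1.choose_spec
  exact (comp_eqToHom_iff _ _ _).1 this

end IsDiscreteFibration

/-! ### Strict pullbacks -/

/-- Objects of the pullback `A ×_B C` of two functors `F : A ⥤ B` and `G : C ⥤ B`. -/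
@[ext]
structure StrictPullback {A B C : Type u} [Groupoid.{u} A] [Groupoid.{u} B] [Groupoid.{u} C]
    (F : A ⥤ B) (G : C ⥤ B) : Type u where
  /-- the object of `A` -/
  fst : A
  /-- the object of `C` -/
  snd : C
  eq : F.obj fst = G.obj snd

namespace StrictPullback

variable {A B C : Type u} [Groupoid.{u} A] [Groupoid.{u} B] [Groupoid.{u} C] {F : A ⥤ B} {G : C ⥤ B}

/-- Morphisms of the pullback `A ×_B C`: pairs of morphisms with the same image in `B`. -/
@[ext]
structure Hom (x y : StrictPullback F G) : Type u where
  /-- the morphism of `A` -/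
  fst : x.fst ⟶ y.fst
  /-- the morphism of `C` -/
  snd : x.snd ⟶ y.snd
  w : F.map fst ≫ eqToHom y.eq = eqToHom x.eq ≫ G.map snd

instance : Groupoid (StrictPullback F G) where
  Hom := Hom
  id x := ⟨𝟙 _, 𝟙 _, by simp⟩
  comp f g := ⟨f.fst ≫ g.fst, f.snd ≫ g.snd, by
    rw [F.map_comp, G.map_comp, Category.assoc, g.w, reassoc_of% f.w]⟩
  inv f := ⟨Groupoid.inv f.fst, Groupoid.inv f.snd, by
    simp [← f.w]⟩
  inv_comp f := by apply Hom.ext <;> simp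
  comp_inv f := by apply Hom.ext <;> simp
  id_comp f := by apply Hom.ext <;> simp
  comp_id f := by apply Hom.ext <;> simp
  assoc f g h := by apply Hom.ext <;> simp

@[ext] theorem hom_ext {x y : StrictPullback F G} {f g : x ⟶ y} (h₁ : f.fst = g.fst)
    (h₂ : f.snd = g.snd) : f = g := Hom.ext h₁ h₂

@[simp] theorem id_fst (x : StrictPullback F G) : Hom.fst (𝟙 x) = 𝟙 x.fst := rfl
@[simp] theorem id_snd (x : StrictPullback F G) : Hom.snd (𝟙 x) = 𝟙 x.snd := rfl
@[simp] theorem comp_fst {x y z : StrictPullback F G} (f : x ⟶ y) (g : y ⟶ z) :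
    (f ≫ g).fst = f.fst ≫ g.fst := rfl
@[simp] theorem comp_snd {x y z : StrictPullback F G} (f : x ⟶ y) (g : y ⟶ z) :
    (f ≫ g).snd = f.snd ≫ g.snd := rfl

instance [Finite A] [Finite C] : Finite (StrictPullback F G) :=
  Finite.of_injective (fun x => (x.fst, x.snd)) fun x y h => by
    cases x; cases y; cases h; rfl

instance [∀ a a' : A, Finite (a ⟶ a')] [∀ c c' : C, Finite (c ⟶ c')] (x y : StrictPullback F G) :
    Finite (x ⟶ y) :=
  Finite.of_injective (fun f : x ⟶ y => (f.fst, f.snd)) fun f g h => by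
    simp only [Prod.mk.injEq] at h
    exact hom_ext h.1 h.2

variable (F G)

/-- The first projection. -/
@[simps] def π₁ : StrictPullback F G ⥤ A where
  obj x := x.fst
  map f := f.fst

/-- The second projection. -/
@[simps] def π₂ : StrictPullback F G ⥤ C where
  obj x := x.snd
  map f := f.snd

variable {F G}

theorem isDiscreteFibration_π₁ (hG : IsDiscreteFibration G) : IsDiscreteFibration (π₁ F G) := by
  intro x a f
  change x.fst ⟶ a at f
  let f' : G.obj x.snd ⟶ F.obj a := eqToHom x.eq.symm ≫ F.map f
  refine ⟨⟨⟨a, hG.liftObj x.snd f', (hG.obj_liftObj _ _).symm⟩, ⟨f, hG.lift x.snd f', ?_⟩⟩,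
    ⟨rfl, ?_⟩, ?_⟩
  · simp [hG.map_lift, f']
  · exact Category.comp_id f
  · rintro ⟨⟨a', c', h'⟩, ⟨g, k, w⟩⟩ ⟨h, hg⟩
    change a' = a at h
    subst h
    obtain rfl : g = f := (Category.comp_id g).symm.trans hg
    clear hg
    dsimp only at w k h'
    obtain ⟨e, he⟩ := hG.faithful k (hG.lift x.snd f')
      (h'.symm.trans (hG.obj_liftObj _ _).symm) (by
        rw [hG.map_lift, ← cancel_epi (eqToHom x.eq), ← reassoc_of% w]
        simp [f'])
    generalize_proofs at *
    generalize hG.lift x.snd f' = l at *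
    generalize hG.liftObj x.snd f' = c'' at *
    subst e
    obtain rfl : k = l := by simpa using he
    rfl

end StrictPullback

/-! ### The global effective Burnside 2-category -/

/-- A span `𝒢 ← 𝒦 → ℋ` of finite groupoids whose left leg is a discrete fibration. -/
structure BurnSpan (𝒢 ℋ : FinGrpd.{u}) where
  /-- the apex `𝒦` -/
  apex : FinGrpd.{u}
  /-- the left leg -/
  left : apex.carrier ⥤ 𝒢.carrier
  /-- the right leg -/
  right : apex.carrier ⥤ ℋ.carrier
  fib : IsDiscreteFibration left

namespace BurnSpan

variable {𝒢 ℋ 𝒥 ℒ : FinGrpd.{u}}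

/-- A 2-morphism of spans, from `𝒢 ← 𝒦 → ℋ` to `𝒢 ← 𝒦' → ℋ`: a functor `𝒦 ⥤ 𝒦'` which commutes
with the left legs, and commutes with the right legs up to a specified natural isomorphism.
(A natural transformation between functors to a groupoid is invertible. Since the left leg of the
target is a discrete fibration, a functor that commutes with the left legs up to a natural
isomorphism is isomorphic, in a unique way compatible with that isomorphism, to one which commutes
with them strictly.) -/
structure Hom (S T : BurnSpan 𝒢 ℋ) : Type u where
  /-- the functor between the apices -/
  functor : S.apex.carrier ⥤ T.apex.carrier
  w : functor ⋙ T.left = S.left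
  /-- the natural isomorphism between the right legs -/
  iso : S.right ⟶ functor ⋙ T.right

variable {S T U : BurnSpan 𝒢 ℋ}

theorem Hom.obj_eq (η : Hom S T) (k : S.apex.carrier) :
    T.left.obj (η.functor.obj k) = S.left.obj k :=
  Functor.congr_obj η.w k

theorem Hom.map_eq (η : Hom S T) {k l : S.apex.carrier} (a : k ⟶ l) :
    T.left.map (η.functor.map a) =
      eqToHom (η.obj_eq k) ≫ S.left.map a ≫ eqToHom (η.obj_eq l).symm :=
  Functor.congr_hom η.w a

theorem Hom.ext_of {η θ : Hom S T}
    (c : ∀ k, η.functor.obj k ⟶ θ.functor.obj k)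
    (hc : ∀ k, T.left.map (c k) = eqToHom ((η.obj_eq k).trans (θ.obj_eq k).symm))
    (hi : ∀ k, η.iso.app k ≫ T.right.map (c k) = θ.iso.app k) : η = θ := by
  have hc' : ∀ k, ∃ e : η.functor.obj k = θ.functor.obj k, c k = eqToHom e := by
    intro k
    obtain ⟨e, he⟩ := T.fib.faithful (𝟙 _) (c k) ((η.obj_eq k).trans (θ.obj_eq k).symm)
      (by simp [hc])
    exact ⟨e, by simpa using he.symm⟩
  have hf : η.functor = θ.functor := by
    refine CategoryTheory.Functor.ext (fun k => (hc' k).choose) fun k l a => ?_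
    obtain ⟨e, he⟩ := T.fib.faithful (η.functor.map a ≫ eqToHom (hc' l).choose)
      (eqToHom (hc' k).choose ≫ θ.functor.map a) rfl (by
        simp [η.map_eq, θ.map_eq, eqToHom_map])
    simp at he
    rw [← cancel_mono (eqToHom (hc' l).choose), he]
    simp
  obtain ⟨f, w, β⟩ := η
  obtain ⟨f', w', β'⟩ := θ
  dsimp at hf
  subst hf
  congr 1
  ext k
  rw [← hi k]
  obtain ⟨e, he⟩ := hc' k
  simp [he]

instance : Category (BurnSpan 𝒢 ℋ) where
  Hom := Hom
  id S := ⟨𝟭 _, rfl, 𝟙 _⟩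
  comp η θ := ⟨η.functor ⋙ θ.functor, by rw [Functor.assoc, θ.w, η.w],
    η.iso ≫ Functor.whiskerLeft η.functor θ.iso⟩
  id_comp η := Hom.ext_of (fun _ => 𝟙 _) (by simp) (by simp)
  comp_id η := Hom.ext_of (fun _ => 𝟙 _) (by simp) (by simp)
  assoc η θ ζ := Hom.ext_of (fun _ => 𝟙 _) (by simp) (by simp)

@[simp] theorem id_functor (S : BurnSpan 𝒢 ℋ) : Hom.functor (𝟙 S) = 𝟭 _ := rfl
@[simp] theorem id_iso (S : BurnSpan 𝒢 ℋ) : Hom.iso (𝟙 S) = 𝟙 S.right := rfl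
@[simp] theorem comp_functor (η : S ⟶ T) (θ : T ⟶ U) :
    (η ≫ θ).functor = η.functor ⋙ θ.functor := rfl
@[simp] theorem comp_iso (η : S ⟶ T) (θ : T ⟶ U) :
    (η ≫ θ).iso = η.iso ≫ Functor.whiskerLeft η.functor θ.iso := rfl

theorem hom_ext_of {η θ : S ⟶ T}
    (c : ∀ k, η.functor.obj k ⟶ θ.functor.obj k)
    (hc : ∀ k, T.left.map (c k) = eqToHom ((η.obj_eq k).trans (θ.obj_eq k).symm))
    (hi : ∀ k, η.iso.app k ≫ T.right.map (c k) = θ.iso.app k) : η = θ :=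
  Hom.ext_of c hc hi

/-- The identity span `𝒢 = 𝒢 = 𝒢`. -/
abbrev idSpan (𝒢 : FinGrpd.{u}) : BurnSpan 𝒢 𝒢 where
  apex := 𝒢
  left := 𝟭 _
  right := 𝟭 _
  fib := IsDiscreteFibration.id

/-- The composite of spans, given by the pullback of the right leg of the first span and the left
leg of the second. (A discrete fibration is an isofibration, so this is also the
2-categorical pullback.) -/
abbrev compSpan (S : BurnSpan 𝒢 ℋ) (T : BurnSpan ℋ 𝒥) : BurnSpan 𝒢 𝒥 where
  apex := { carrier := StrictPullback S.right T.left }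
  left := StrictPullback.π₁ S.right T.left ⋙ S.left
  right := StrictPullback.π₂ S.right T.left ⋙ T.right
  fib := (StrictPullback.isDiscreteFibration_π₁ T.fib).comp S.fib

/-- The functor `(k, l) ↦ (k, η l)` between the apices of composites. -/
@[simps] def whiskerLFunctor (S : BurnSpan 𝒢 ℋ) {T T' : BurnSpan ℋ 𝒥} (η : T ⟶ T') :
    StrictPullback S.right T.left ⥤ StrictPullback S.right T'.left where
  obj x := ⟨x.fst, η.functor.obj x.snd, x.eq.trans (η.obj_eq x.snd).symm⟩
  map f := ⟨f.fst, η.functor.map f.snd, by simp [η.map_eq, ← reassoc_of% f.w]⟩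

/-- Left whiskering, given by the functor `(k, l) ↦ (k, η l)`. -/
def whiskerL (S : BurnSpan 𝒢 ℋ) {T T' : BurnSpan ℋ 𝒥} (η : T ⟶ T') :
    compSpan S T ⟶ compSpan S T' where
  functor := whiskerLFunctor S η
  w := rfl
  iso :=
    { app := fun x : StrictPullback S.right T.left => η.iso.app x.snd
      naturality := fun x y (f : StrictPullback.Hom x y) => η.iso.naturality f.snd }

/-- The morphism that is lifted in the definition of right whiskering. -/
abbrev liftMap {S S' : BurnSpan 𝒢 ℋ} (η : S ⟶ S') (T : BurnSpan ℋ 𝒥)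
    (x : StrictPullback S.right T.left) :
    T.left.obj x.snd ⟶ S'.right.obj (η.functor.obj x.fst) :=
  eqToHom x.eq.symm ≫ η.iso.app x.fst

/-- The lift used in the definition of right whiskering. -/
noncomputable def liftR {S S' : BurnSpan 𝒢 ℋ} (η : S ⟶ S') (T : BurnSpan ℋ 𝒥)
    (x : StrictPullback S.right T.left) :
    x.snd ⟶ T.fib.liftObj x.snd (liftMap η T x) :=
  T.fib.lift x.snd (liftMap η T x)

theorem map_liftR {S S' : BurnSpan 𝒢 ℋ} (η : S ⟶ S') (T : BurnSpan ℋ 𝒥)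
    (x : StrictPullback S.right T.left) :
    T.left.map (liftR η T x) = eqToHom x.eq.symm ≫ η.iso.app x.fst ≫
      eqToHom (T.fib.obj_liftObj x.snd (liftMap η T x)).symm := by
  simp [liftR, T.fib.map_lift]

/-- The functor `(k, l) ↦ (η k, l')` between the apices of composites, where `l'` is the endpoint
of the lift, starting at `l`, of the given isomorphism between the right legs at `k`. -/
@[simps] noncomputable def whiskerRFunctor {S S' : BurnSpan 𝒢 ℋ} (η : S ⟶ S')
    (T : BurnSpan ℋ 𝒥) : StrictPullback S.right T.left ⥤ StrictPullback S'.right T.left where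
  obj x := ⟨η.functor.obj x.fst, T.fib.liftObj x.snd (liftMap η T x),
    (T.fib.obj_liftObj _ _).symm⟩
  map {x y} f := ⟨η.functor.map f.fst,
    Groupoid.inv (liftR η T x) ≫ f.snd ≫ liftR η T y, by
      have h := η.iso.naturality f.fst
      dsimp only [Functor.comp_map] at h
      have hw : T.left.map f.snd =
          eqToHom x.eq.symm ≫ S.right.map f.fst ≫ eqToHom y.eq := by simp [f.w]
      simp [map_liftR, hw, reassoc_of% h]⟩

/-- Right whiskering, given by the functor `(k, l) ↦ (η k, l')`, where `l'` is the endpoint of the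
lift, starting at `l`, of the given isomorphism between the right legs at `k`. -/
noncomputable def whiskerR {S S' : BurnSpan 𝒢 ℋ} (η : S ⟶ S') (T : BurnSpan ℋ 𝒥) :
    compSpan S T ⟶ compSpan S' T where
  functor := whiskerRFunctor η T
  w := congrArg (fun F => StrictPullback.π₁ S.right T.left ⋙ F) η.w
  iso :=
    { app := fun x : StrictPullback S.right T.left => T.right.map (liftR η T x)
      naturality := fun x y (f : StrictPullback.Hom x y) => by
        have h : T.right.map f.snd ≫ T.right.map (liftR η T y) = T.right.map (liftR η T x) ≫
            T.right.map (Groupoid.inv (liftR η T x) ≫ f.snd ≫ liftR η T y) := by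
          simp
        exact h }

/-- The isomorphism of spans given by mutually inverse functors between the apices which are
strictly compatible with both legs. -/
@[simps] def isoOf {S T : BurnSpan 𝒢 ℋ} (f : S.apex.carrier ⥤ T.apex.carrier)
    (g : T.apex.carrier ⥤ S.apex.carrier) (fg : ∀ k, g.obj (f.obj k) = k)
    (gf : ∀ k, f.obj (g.obj k) = k)
    (hl : f ⋙ T.left = S.left) (hr : f ⋙ T.right = S.right)
    (hl' : g ⋙ S.left = T.left) (hr' : g ⋙ S.right = T.right) : S ≅ T where
  hom := ⟨f, hl, ⟨fun k => eqToHom (Functor.congr_obj hr.symm k), fun k l a => by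
    simp [Functor.congr_hom hr.symm a]⟩⟩
  inv := ⟨g, hl', ⟨fun k => eqToHom (Functor.congr_obj hr'.symm k), fun k l a => by
    simp [Functor.congr_hom hr'.symm a]⟩⟩
  hom_inv_id := hom_ext_of (fun k => eqToHom (fg k))
    (fun k => by simp [eqToHom_map]) (fun k => by simp [eqToHom_map])
  inv_hom_id := hom_ext_of (fun k => eqToHom (gf k))
    (fun k => by simp [eqToHom_map]) (fun k => by simp [eqToHom_map])

/-- The functor `((k, l), m) ↦ (k, (l, m))`. -/
@[simps] def assocFunctor (S : BurnSpan 𝒢 ℋ) (T : BurnSpan ℋ 𝒥) (U : BurnSpan 𝒥 ℒ) :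
    StrictPullback (StrictPullback.π₂ S.right T.left ⋙ T.right) U.left ⥤
      StrictPullback S.right (StrictPullback.π₁ T.right U.left ⋙ T.left) where
  obj x := ⟨x.fst.fst, ⟨x.fst.snd, x.snd, x.eq⟩, x.fst.eq⟩
  map {x y} f := ⟨f.fst.fst, StrictPullback.Hom.mk f.fst.snd f.snd f.w, f.fst.w⟩

/-- The functor `(k, (l, m)) ↦ ((k, l), m)`. -/
@[simps] def assocInvFunctor (S : BurnSpan 𝒢 ℋ) (T : BurnSpan ℋ 𝒥) (U : BurnSpan 𝒥 ℒ) :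
    StrictPullback S.right (StrictPullback.π₁ T.right U.left ⋙ T.left) ⥤
      StrictPullback (StrictPullback.π₂ S.right T.left ⋙ T.right) U.left where
  obj x := ⟨⟨x.fst, x.snd.fst, x.eq⟩, x.snd.snd, x.snd.eq⟩
  map {x y} f := ⟨StrictPullback.Hom.mk f.fst f.snd.fst f.w, f.snd.snd, f.snd.w⟩

/-- The associator, given by `((k, l), m) ↦ (k, (l, m))`. -/
def assoc (S : BurnSpan 𝒢 ℋ) (T : BurnSpan ℋ 𝒥) (U : BurnSpan 𝒥 ℒ) :
    compSpan (compSpan S T) U ≅ compSpan S (compSpan T U) :=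
  isoOf (assocFunctor S T U) (assocInvFunctor S T U) (fun _ => rfl) (fun _ => rfl)
    rfl rfl rfl rfl

/-- The functor `k ↦ (p k, k)`. -/
@[simps] def leftUnitorInvFunctor (S : BurnSpan 𝒢 ℋ) :
    S.apex.carrier ⥤ StrictPullback (𝟭 𝒢.carrier) S.left where
  obj k := ⟨S.left.obj k, k, rfl⟩
  map a := ⟨S.left.map a, a, by simp⟩

/-- The functor `k ↦ (k, q k)`. -/
@[simps] def rightUnitorInvFunctor (S : BurnSpan 𝒢 ℋ) :
    S.apex.carrier ⥤ StrictPullback S.right (𝟭 ℋ.carrier) where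
  obj k := ⟨k, S.right.obj k, rfl⟩
  map a := ⟨a, S.right.map a, by simp⟩

/-- The left unitor, given by `(g, k) ↦ k` for `g = p k`. -/
def leftUnitor (S : BurnSpan 𝒢 ℋ) : compSpan (idSpan 𝒢) S ≅ S :=
  isoOf (StrictPullback.π₂ (𝟭 𝒢.carrier) S.left) (leftUnitorInvFunctor S)
    (fun x => StrictPullback.ext (StrictPullback.eq x).symm rfl) (fun _ => rfl)
    (CategoryTheory.Functor.ext (fun x => (StrictPullback.eq x).symm)
      (fun x y f => by
        have h := StrictPullback.Hom.w f
        rw [comp_eqToHom_iff, Category.assoc] at h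
        have h' : S.left.map f.snd = eqToHom (StrictPullback.eq x).symm ≫
            (eqToHom (StrictPullback.eq x) ≫ S.left.map f.snd ≫
              eqToHom (StrictPullback.eq y).symm) ≫ eqToHom (StrictPullback.eq y) := by
          simp
        exact h'.trans (congrArg (fun z => eqToHom (StrictPullback.eq x).symm ≫ z ≫
          eqToHom (StrictPullback.eq y)) h.symm)))
    rfl rfl rfl

/-- The right unitor, given by `(k, h) ↦ k` for `h = q k`. -/
def rightUnitor (S : BurnSpan 𝒢 ℋ) : compSpan S (idSpan ℋ) ≅ S :=
  isoOf (StrictPullback.π₁ S.right (𝟭 ℋ.carrier)) (rightUnitorInvFunctor S)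
    (fun x => StrictPullback.ext rfl (StrictPullback.eq x)) (fun _ => rfl)
    rfl
    (CategoryTheory.Functor.ext (fun x => (StrictPullback.eq x))
      (fun x y f => by
        have h := StrictPullback.Hom.w f
        rw [comp_eqToHom_iff, Category.assoc] at h
        exact h))
    rfl rfl

theorem hom_ext_pullback {R : BurnSpan 𝒢 𝒥} {S : BurnSpan 𝒢 ℋ} {T : BurnSpan ℋ 𝒥}
    {η θ : R ⟶ compSpan S T}
    (h : ∀ k, ((η.functor.obj k : StrictPullback S.right T.left)).fst =
      ((θ.functor.obj k : StrictPullback S.right T.left)).fst)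
    (c : ∀ k, ((η.functor.obj k : StrictPullback S.right T.left)).snd ⟶
      ((θ.functor.obj k : StrictPullback S.right T.left)).snd)
    (hc : ∀ k, T.left.map (c k) =
      eqToHom ((StrictPullback.eq (F := S.right) (G := T.left) _).symm.trans
        ((congrArg S.right.obj (h k)).trans (StrictPullback.eq _))))
    (hi : ∀ k, η.iso.app k ≫ T.right.map (c k) = θ.iso.app k) : η = θ :=
  hom_ext_of
    (fun k => (StrictPullback.Hom.mk (eqToHom (h k)) (c k) (by rw [hc]; simp [eqToHom_map]) :
      StrictPullback.Hom (F := S.right) (G := T.left) _ _))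
    (fun k => (eqToHom_map S.left (h k))) hi

/-- The pairs `(k, l)` forming the apex of a composite. -/
abbrev Pairs (S : BurnSpan 𝒢 ℋ) (T : BurnSpan ℋ 𝒥) := StrictPullback S.right T.left

theorem whiskerL_id (S : BurnSpan 𝒢 ℋ) (T : BurnSpan ℋ 𝒥) :
    whiskerL S (𝟙 T) = 𝟙 (compSpan S T) := by
  refine hom_ext_pullback (fun _ => rfl) (fun (k : Pairs S T) => 𝟙 k.snd) ?_ ?_
  · intro (k : Pairs S T)
    exact T.left.map_id k.snd
  · intro (k : Pairs S T)
    have h : 𝟙 (T.right.obj k.snd) ≫ T.right.map (𝟙 k.snd) = 𝟙 _ := by simp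
    exact h

theorem whiskerL_comp (S : BurnSpan 𝒢 ℋ) {T T' T'' : BurnSpan ℋ 𝒥} (η : T ⟶ T') (θ : T' ⟶ T'') :
    whiskerL S (η ≫ θ) = whiskerL S η ≫ whiskerL S θ := by
  refine hom_ext_pullback (fun _ => rfl)
    (fun (k : Pairs S T) => 𝟙 (θ.functor.obj (η.functor.obj k.snd))) ?_ ?_
  · intro (k : Pairs S T)
    exact T''.left.map_id _
  · intro (k : Pairs S T)
    have h : (η.iso.app k.snd ≫ θ.iso.app (η.functor.obj k.snd)) ≫
        T''.right.map (𝟙 (θ.functor.obj (η.functor.obj k.snd))) =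
        η.iso.app k.snd ≫ θ.iso.app (η.functor.obj k.snd) := by simp
    exact h

theorem id_whiskerL {S T : BurnSpan 𝒢 ℋ} (η : S ⟶ T) :
    whiskerL (idSpan 𝒢) η = (leftUnitor S).hom ≫ η ≫ (leftUnitor T).inv := by
  refine hom_ext_pullback (fun (k : Pairs (idSpan 𝒢) S) => k.eq.trans (η.obj_eq k.snd).symm)
    (fun (k : Pairs (idSpan 𝒢) S) => 𝟙 (η.functor.obj k.snd)) ?_ ?_
  · intro (k : Pairs (idSpan 𝒢) S)
    exact T.left.map_id _
  · intro (k : Pairs (idSpan 𝒢) S)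
    have h : η.iso.app k.snd ≫ T.right.map (𝟙 (η.functor.obj k.snd)) =
      𝟙 (S.right.obj k.snd) ≫ η.iso.app k.snd ≫ 𝟙 (T.right.obj (η.functor.obj k.snd)) := by simp
    exact h

theorem comp_whiskerL (S : BurnSpan 𝒢 ℋ) (T : BurnSpan ℋ 𝒥) {U U' : BurnSpan 𝒥 ℒ} (η : U ⟶ U') :
    whiskerL (compSpan S T) η =
      (assoc S T U).hom ≫ whiskerL S (whiskerL T η) ≫ (assoc S T U').inv := by
  refine hom_ext_pullback (fun _ => rfl)
    (fun (k : Pairs (compSpan S T) U) => 𝟙 (η.functor.obj k.snd)) ?_ ?_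
  · intro (k : Pairs (compSpan S T) U)
    exact U'.left.map_id _
  · intro (k : Pairs (compSpan S T) U)
    have h : η.iso.app k.snd ≫ U'.right.map (𝟙 (η.functor.obj k.snd)) =
      𝟙 (U.right.obj k.snd) ≫ η.iso.app k.snd ≫ 𝟙 (U'.right.obj (η.functor.obj k.snd)) := by simp
    exact h

theorem id_whiskerR (S : BurnSpan 𝒢 ℋ) (T : BurnSpan ℋ 𝒥) :
    whiskerR (𝟙 S) T = 𝟙 (compSpan S T) := by
  refine hom_ext_pullback (fun _ => rfl) (fun (k : Pairs S T) => Groupoid.inv (liftR (𝟙 S) T k))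
    ?_ ?_
  · intro (k : Pairs S T)
    have h : T.left.map (Groupoid.inv (liftR (𝟙 S) T k)) = eqToHom
      ((T.fib.obj_liftObj k.snd (liftMap (𝟙 S) T k)).trans k.eq) := by simp [map_liftR]
    exact h
  · intro (k : Pairs S T)
    have h : T.right.map (liftR (𝟙 S) T k) ≫ T.right.map (Groupoid.inv (liftR (𝟙 S) T k)) =
      𝟙 _ := by simp
    exact h

/-- The image of a pair under right whiskering. -/
noncomputable abbrev pairR {S S' : BurnSpan 𝒢 ℋ} (η : S ⟶ S') (T : BurnSpan ℋ 𝒥) (k : Pairs S T) :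
    Pairs S' T :=
  ⟨η.functor.obj k.fst, T.fib.liftObj k.snd (liftMap η T k), (T.fib.obj_liftObj _ _).symm⟩

/-- The image of a pair under left whiskering. -/
abbrev pairL (S : BurnSpan 𝒢 ℋ) {T T' : BurnSpan ℋ 𝒥} (η : T ⟶ T') (k : Pairs S T) :
    Pairs S T' :=
  ⟨k.fst, η.functor.obj k.snd, k.eq.trans (η.obj_eq k.snd).symm⟩

theorem comp_whiskerR {S S' S'' : BurnSpan 𝒢 ℋ} (η : S ⟶ S') (θ : S' ⟶ S'') (T : BurnSpan ℋ 𝒥) :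
    whiskerR (η ≫ θ) T = whiskerR η T ≫ whiskerR θ T := by
  refine hom_ext_pullback (fun _ => rfl) (fun (k : Pairs S T) =>
    Groupoid.inv (liftR (η ≫ θ) T k) ≫ liftR η T k ≫ liftR θ T (pairR η T k)) ?_ ?_
  · intro (k : Pairs S T)
    have h : T.left.map (Groupoid.inv (liftR (η ≫ θ) T k) ≫ liftR η T k ≫
        liftR θ T (pairR η T k)) = eqToHom
        ((T.fib.obj_liftObj _ _).trans (T.fib.obj_liftObj _ _).symm) := by
      simp [map_liftR]
    exact h
  · intro (k : Pairs S T)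
    have h : T.right.map (liftR (η ≫ θ) T k) ≫ T.right.map (Groupoid.inv (liftR (η ≫ θ) T k) ≫
        liftR η T k ≫ liftR θ T (pairR η T k)) =
        T.right.map (liftR η T k) ≫ T.right.map (liftR θ T (pairR η T k)) := by
      simp
    exact h

theorem whiskerR_id {S S' : BurnSpan 𝒢 ℋ} (η : S ⟶ S') :
    whiskerR η (idSpan ℋ) = (rightUnitor S).hom ≫ η ≫ (rightUnitor S').inv := by
  refine hom_ext_pullback (fun _ => rfl) (fun (k : Pairs S (idSpan ℋ)) =>
    Groupoid.inv (liftR η (idSpan ℋ) k) ≫ eqToHom k.eq.symm ≫ η.iso.app k.fst) ?_ ?_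
  · intro (k : Pairs S (idSpan ℋ))
    have h : Groupoid.inv ((idSpan ℋ).left.map (liftR η (idSpan ℋ) k)) ≫
        eqToHom k.eq.symm ≫ η.iso.app k.fst =
        eqToHom ((idSpan ℋ).fib.obj_liftObj k.snd (liftMap η (idSpan ℋ) k)) := by
      rw [map_liftR]
      simp
    exact h
  · intro (k : Pairs S (idSpan ℋ))
    have h : liftR η (idSpan ℋ) k ≫ Groupoid.inv (liftR η (idSpan ℋ) k) ≫ eqToHom k.eq.symm ≫
        η.iso.app k.fst = eqToHom k.eq.symm ≫ η.iso.app k.fst ≫ 𝟙 _ := by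
      simp
    exact h

theorem whisker_assoc (S : BurnSpan 𝒢 ℋ) {T T' : BurnSpan ℋ 𝒥} (η : T ⟶ T') (U : BurnSpan 𝒥 ℒ) :
    whiskerR (whiskerL S η) U =
      (assoc S T U).hom ≫ whiskerL S (whiskerR η U) ≫ (assoc S T' U).inv := by
  refine hom_ext_pullback (fun _ => rfl) (fun (k : Pairs (compSpan S T) U) =>
    𝟙 (U.fib.liftObj k.snd (liftMap η U ⟨k.fst.snd, k.snd, k.eq⟩))) ?_ ?_
  · intro (k : Pairs (compSpan S T) U)
    exact U.left.map_id _
  · intro (k : Pairs (compSpan S T) U)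
    have h : U.right.map (liftR η U ⟨k.fst.snd, k.snd, k.eq⟩) ≫
      U.right.map (𝟙 (U.fib.liftObj k.snd (liftMap η U ⟨k.fst.snd, k.snd, k.eq⟩))) =
      𝟙 _ ≫ U.right.map (liftR η U ⟨k.fst.snd, k.snd, k.eq⟩) ≫ 𝟙 _ := by
      simp
    exact h

theorem whisker_exchange {S S' : BurnSpan 𝒢 ℋ} {T T' : BurnSpan ℋ 𝒥}
    (η : S ⟶ S') (θ : T ⟶ T') :
    whiskerL S θ ≫ whiskerR η T' = whiskerR η T ≫ whiskerL S' θ := by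
  refine hom_ext_pullback (fun _ => rfl) (fun (k : Pairs S T) =>
    Groupoid.inv (liftR η T' (pairL S θ k)) ≫ θ.functor.map (liftR η T k)) ?_ ?_
  · intro (k : Pairs S T)
    have h : T'.left.map (Groupoid.inv (liftR η T' (pairL S θ k)) ≫
        θ.functor.map (liftR η T k)) = eqToHom ((T'.fib.obj_liftObj _ _).trans
        ((T.fib.obj_liftObj _ _).symm.trans (θ.obj_eq _).symm)) := by
      simp [map_liftR, θ.map_eq]
    exact h
  · intro (k : Pairs S T)
    have hn := θ.iso.naturality (liftR η T k)
    have h : (θ.iso.app k.snd ≫ T'.right.map (liftR η T' (pairL S θ k))) ≫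
        T'.right.map (Groupoid.inv (liftR η T' (pairL S θ k)) ≫
          θ.functor.map (liftR η T k)) =
        T.right.map (liftR η T k) ≫ θ.iso.app _ := by
      rw [hn]
      simp
    exact h

theorem eqToHom_trans₃ {C : Type*} [Category* C] {a b c d : C} (p : a = b) (q : b = c)
    (r : c = d) : eqToHom p ≫ eqToHom q ≫ eqToHom r = eqToHom (p.trans (q.trans r)) := by
  simp

theorem triangle (S : BurnSpan 𝒢 ℋ) (T : BurnSpan ℋ 𝒥) :
    (assoc S (idSpan ℋ) T).hom ≫ whiskerL S (leftUnitor T).hom = whiskerR (rightUnitor S).hom T := by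
  refine hom_ext_pullback (fun _ => rfl) (fun (k : Pairs (compSpan S (idSpan ℋ)) T) =>
    liftR (rightUnitor S).hom T k) ?_ ?_
  · intro (k : Pairs (compSpan S (idSpan ℋ)) T)
    refine (map_liftR (rightUnitor S).hom T k).trans ?_
    have h : eqToHom k.eq.symm ≫ eqToHom k.fst.eq.symm ≫ eqToHom (T.fib.obj_liftObj k.snd
      (liftMap (rightUnitor S).hom T k)).symm = eqToHom (k.eq.symm.trans (k.fst.eq.symm.trans
        (T.fib.obj_liftObj k.snd (liftMap (rightUnitor S).hom T k)).symm)) := by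
      exact eqToHom_trans₃ _ _ _
    exact h
  · intro (k : Pairs (compSpan S (idSpan ℋ)) T)
    have h : (𝟙 (T.right.obj k.snd) ≫ 𝟙 (T.right.obj k.snd)) ≫
      T.right.map (liftR (rightUnitor S).hom T k) = T.right.map (liftR (rightUnitor S).hom T k) := by
      simp
    exact h

section

variable {C D : Type*} [Groupoid C] [Groupoid D]

theorem map_ginv (F : C ⥤ D) {a b : C} (f : a ⟶ b) :
    F.map (Groupoid.inv f) = Groupoid.inv (F.map f) := by
  simp

theorem map_map_ginv_comp (F : C ⥤ D) {a b c : C} (f : a ⟶ b) (g : a ⟶ c) :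
    F.map f ≫ F.map (Groupoid.inv f ≫ g) = F.map g := by
  simp

theorem ginv_comp_eqToHom {a b c d d' : C} (p : a = b) (β : b ⟶ c) (q : c = d) (q' : c = d') :
    Groupoid.inv (eqToHom p ≫ β ≫ eqToHom q) ≫ eqToHom p ≫ β ≫ eqToHom q' =
      eqToHom (q.symm.trans q') := by
  subst p q q'
  simp

theorem ginv_eqToHom {a b c d : C} (p : a = b) (q : b = c) (r : c = d) :
    Groupoid.inv (eqToHom p ≫ eqToHom q ≫ eqToHom r) =
      eqToHom (p.trans (q.trans r)).symm := by
  subst p q r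
  simp

theorem eqToHom_aux {a b c : C} (p : a = b) (q : c = a) (r : c = b) :
    eqToHom p = eqToHom q.symm ≫ eqToHom r := by
  subst p q
  simp

end

theorem pentagon {ℳ : FinGrpd.{u}} (S : BurnSpan 𝒢 ℋ) (T : BurnSpan ℋ 𝒥) (U : BurnSpan 𝒥 ℒ)
    (V : BurnSpan ℒ ℳ) :
    whiskerR (assoc S T U).hom V ≫ (assoc S (compSpan T U) V).hom ≫ whiskerL S (assoc T U V).hom =
      (assoc (compSpan S T) U V).hom ≫ (assoc S T (compSpan U V)).hom := by
  refine hom_ext_pullback (fun _ => rfl) (fun (k : Pairs (compSpan (compSpan S T) U) V) =>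
    (StrictPullback.Hom.mk (𝟙 k.fst.fst.snd)
      (StrictPullback.Hom.mk (𝟙 k.fst.snd) (Groupoid.inv (liftR (assoc S T U).hom V k)) (by
        have h₁ : V.left.map (Groupoid.inv (liftR (assoc S T U).hom V k)) =
            eqToHom ((V.fib.obj_liftObj k.snd (liftMap (assoc S T U).hom V k)).trans k.eq) := by
          have h₂ : (assoc S T U).hom.iso.app k.fst = eqToHom rfl := rfl
          rw [map_ginv, map_liftR, h₂]
          exact ginv_eqToHom _ _ _
        have h : U.right.map (𝟙 k.fst.snd) ≫ eqToHom k.eq =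
            eqToHom (V.fib.obj_liftObj k.snd (liftMap (assoc S T U).hom V k)).symm ≫
              V.left.map (Groupoid.inv (liftR (assoc S T U).hom V k)) := by
          rw [h₁, U.right.map_id, Category.id_comp]
          exact eqToHom_aux _ (V.fib.obj_liftObj k.snd (liftMap (assoc S T U).hom V k)) _
        exact h) :
        StrictPullback.Hom (F := U.right) (G := V.left) _ _) (by
        have h : T.right.map (𝟙 k.fst.fst.snd) ≫ eqToHom k.fst.eq =
          eqToHom k.fst.eq ≫ U.left.map (𝟙 k.fst.snd) := by
          rw [T.right.map_id, U.left.map_id, Category.id_comp]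
          exact (Category.comp_id _).symm
        exact h) :
      StrictPullback.Hom (F := T.right) (G := (compSpan U V).left) _ _)) ?_ ?_
  · intro (k : Pairs (compSpan (compSpan S T) U) V)
    exact T.left.map_id k.fst.fst.snd
  · intro (k : Pairs (compSpan (compSpan S T) U) V)
    have h : (V.right.map (liftR (assoc S T U).hom V k) ≫ 𝟙 _ ≫ 𝟙 _) ≫
        V.right.map (Groupoid.inv (liftR (assoc S T U).hom V k)) =
        𝟙 (V.right.obj k.snd) ≫ 𝟙 (V.right.obj k.snd) := by
      simp
    exact h

theorem whiskerR_comp {S S' : BurnSpan 𝒢 ℋ} (η : S ⟶ S') (T : BurnSpan ℋ 𝒥) (U : BurnSpan 𝒥 ℒ) :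
    whiskerR η (compSpan T U) =
      (assoc S T U).inv ≫ whiskerR (whiskerR η T) U ≫ (assoc S' T U).hom := by
  let c (k : Pairs S (compSpan T U)) : StrictPullback.mk (F := T.right) (G := U.left)
      k.snd.fst k.snd.snd k.snd.eq ⟶ StrictPullback.mk (F := T.right) (G := U.left) _ _
        (U.fib.obj_liftObj k.snd.snd (liftMap (whiskerR η T) U
          ⟨⟨k.fst, k.snd.fst, k.eq⟩, k.snd.snd, k.snd.eq⟩)).symm :=
    StrictPullback.Hom.mk (liftR η T ⟨k.fst, k.snd.fst, k.eq⟩)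
      (liftR (whiskerR η T) U ⟨⟨k.fst, k.snd.fst, k.eq⟩, k.snd.snd, k.snd.eq⟩) (by
        have h : T.right.map (liftR η T ⟨k.fst, k.snd.fst, k.eq⟩) ≫
            eqToHom (U.fib.obj_liftObj k.snd.snd (liftMap (whiskerR η T) U
              ⟨⟨k.fst, k.snd.fst, k.eq⟩, k.snd.snd, k.snd.eq⟩)).symm =
            eqToHom k.snd.eq ≫ eqToHom k.snd.eq.symm ≫
            T.right.map (liftR η T ⟨k.fst, k.snd.fst, k.eq⟩) ≫
            eqToHom (U.fib.obj_liftObj k.snd.snd (liftMap (whiskerR η T) U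
              ⟨⟨k.fst, k.snd.fst, k.eq⟩, k.snd.snd, k.snd.eq⟩)).symm := by
          rw [eqToHom_trans_assoc, eqToHom_refl, Category.id_comp]
        rw [map_liftR]
        exact h)
  refine hom_ext_pullback (fun _ => rfl) (fun (k : Pairs S (compSpan T U)) =>
    Groupoid.inv (liftR η (compSpan T U) k) ≫ c k) ?_ ?_
  · intro (k : Pairs S (compSpan T U))
    have h : Groupoid.inv ((compSpan T U).left.map (liftR η (compSpan T U) k)) ≫
        T.left.map (liftR η T ⟨k.fst, k.snd.fst, k.eq⟩) =
        eqToHom (((compSpan T U).fib.obj_liftObj k.snd (liftMap η (compSpan T U) k)).trans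
          (T.fib.obj_liftObj k.snd.fst (liftMap η T ⟨k.fst, k.snd.fst, k.eq⟩)).symm) := by
      rw [map_liftR]
      exact (congrArg (fun z => _ ≫ z) (map_liftR η T ⟨k.fst, k.snd.fst, k.eq⟩)).trans
        (ginv_comp_eqToHom k.eq.symm (η.iso.app k.fst) _ _)
    refine Eq.trans ?_ h
    exact ((compSpan T U).left.map_comp _ _).trans
      (congrArg (fun z => z ≫ T.left.map (liftR η T ⟨k.fst, k.snd.fst, k.eq⟩))
        (map_ginv (compSpan T U).left (liftR η (compSpan T U) k)))
  · intro (k : Pairs S (compSpan T U))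
    have h₁ : (compSpan T U).right.map (liftR η (compSpan T U) k) ≫ (compSpan T U).right.map
        (Groupoid.inv (liftR η (compSpan T U) k) ≫ c k) = (compSpan T U).right.map (c k) :=
      map_map_ginv_comp (compSpan T U).right (liftR η (compSpan T U) k) (c k)
    refine h₁.trans ?_
    have h : U.right.map (liftR (whiskerR η T) U
        ⟨⟨k.fst, k.snd.fst, k.eq⟩, k.snd.snd, k.snd.eq⟩) = 𝟙 _ ≫ U.right.map
        (liftR (whiskerR η T) U ⟨⟨k.fst, k.snd.fst, k.eq⟩, k.snd.snd, k.snd.eq⟩) ≫ 𝟙 _ := by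
      rw [Category.id_comp, Category.comp_id]
    exact h

end BurnSpan

/-- The global effective Burnside 2-category: objects are finite groupoids. -/
structure BurnGlo where
  /-- the finite groupoid -/
  grpd : FinGrpd.{u}

namespace BurnGlo

open BurnSpan

noncomputable instance : CategoryStruct.{u + 1} BurnGlo.{u} where
  Hom 𝒢 ℋ := BurnSpan 𝒢.grpd ℋ.grpd
  id 𝒢 := idSpan 𝒢.grpd
  comp S T := compSpan S T

instance homCategory (𝒢 ℋ : BurnGlo.{u}) : Category.{u} (𝒢 ⟶ ℋ) :=
  inferInstanceAs (Category (BurnSpan 𝒢.grpd ℋ.grpd))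

/-- The global effective Burnside 2-category `Burn_glo^eff`: objects are finite groupoids, a
1-morphism from `𝒢` to `ℋ` is a span `𝒢 ← 𝒦 → ℋ` of finite groupoids with left leg a discrete
fibration, 2-morphisms are the maps of spans, and composition is by pullback. The (2,1)-category
with only the invertible maps of spans as 2-morphisms is `Bicategory.Pith BurnGlo`. -/
noncomputable instance : Bicategory.{u} BurnGlo.{u} where
  homCategory := homCategory
  whiskerLeft S _ _ η := whiskerL S η
  whiskerRight η T := whiskerR η T
  associator S T U := assoc S T U
  leftUnitor S := leftUnitor S
  rightUnitor S := rightUnitor S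
  whiskerLeft_id S T := whiskerL_id S T
  whiskerLeft_comp S _ _ _ η θ := whiskerL_comp S η θ
  id_whiskerLeft η := id_whiskerL η
  comp_whiskerLeft S T _ _ η := comp_whiskerL S T η
  id_whiskerRight S T := id_whiskerR S T
  comp_whiskerRight η θ T := comp_whiskerR η θ T
  whiskerRight_id η := whiskerR_id η
  whiskerRight_comp η T U := whiskerR_comp η T U
  whisker_assoc S _ _ η U := whisker_assoc S η U
  whisker_exchange η θ := whisker_exchange η θ
  pentagon S T U V := pentagon S T U V
  triangle S T := triangle S T

end BurnGlo

/-- The full sub-2-category of `Cat_pce` spanned by the categories `Fin_𝒢`, for `𝒢` a finite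
groupoid. -/
abbrev FinSub : Type (u + 2) :=
  Bicategory.InducedBicategory CatPCE.{u, u + 1}
    (Subtype.val : Set.range FinGrpd.finCat.{u} → CatPCE.{u, u + 1})

/-! A span `𝒢 ←p 𝒦 →q ℋ` acts by `p_! q^*`. Since `p` is a discrete fibration, the value of `p_! q^*
X` at `g` is the disjoint union of the sets `X (q k)` over the finite fibre `p⁻¹(g)`, and disjoint
unions over a fixed index set preserve pullbacks, finite coproducts and epimorphisms. Identity and
composite spans go to identity and composite functors (`functorOfId`, `functorOfComp`), which gives
a pseudofunctor that hits every object `Fin_𝒢` strictly. It remains to treat the hom-categories.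

Full faithfulness is the Yoneda lemma. Over each `k` in the apex lies a universal element `(k, id)`
of `p_! q^* (rep (q k))`. A natural transformation is determined by its values there (`app_app_eq`),
each of which is an object `k'` of the other apex together with a morphism `q k ⟶ q' k'`. Naturality
in `𝒢` makes `k ↦ k'` a functor (`exists_hom_imgElt`).

For essential surjectivity, let `F` preserve pullbacks, finite coproducts and epimorphisms, and let
`𝒦` be the category of elements of `F(pt)`. The map from the coproduct of all `rep h` to the point
is epi, so each `t ∈ F(pt)(g)` is the image of some `e ∈ F(rep h)(g)` (`exists_rep_elt`). Because
`ℋ` is a groupoid, `X × rep h` is a coproduct of copies of `rep h` indexed by `X(h)`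
(`isColimit_graph`). Applying `F` to this product, viewed as a pullback over the point, shows that
`x ↦ F(x)(e)` is a bijection from `X(h)` to the fibre of `F(X)(g)` over `t`
(`existsUnique_map_repHom`). Hence `F(X)(g)` is the disjoint union of the sets `X(h_t)`. The pairs
`(h_t, e_t)` are chosen separately for each `t`, and the uniqueness in the bijection makes `t ↦ h_t`
a functor, the right leg of the span.

The (2,1)-statement follows by restricting to invertible 2-morphisms. -/

/-! ### Pullbacks, finite coproducts and epimorphisms in terms of elements -/

section FunctorToFintypeCat

variable {J : Type u} [Category.{u} J]

/-- Pullbacks of functors are computed pointwise, and the inclusion of finite sets into types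
preserves and reflects them. -/
theorem isPullback_iff_exists_unique {P X Y Z : J ⥤ FintypeCat.{u}} (p : P ⟶ X) (q : P ⟶ Y)
    (f : X ⟶ Z) (g : Y ⟶ Z) :
    IsPullback p q f g ↔ p ≫ f = q ≫ g ∧ ∀ (j : J) (x : X.obj j) (y : Y.obj j),
      f.app j x = g.app j y → ∃! z : P.obj j, p.app j z = x ∧ q.app j z = y := by
  rw [IsPullback.iff_app]
  have key (j : J) : IsPullback (p.app j) (q.app j) (f.app j) (g.app j) ↔
      IsPullback (FintypeCat.incl.map (p.app j)) (FintypeCat.incl.map (q.app j))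
        (FintypeCat.incl.map (f.app j)) (FintypeCat.incl.map (g.app j)) := by
    refine ⟨fun h => h.map _, fun h => IsPullback.of_map FintypeCat.incl ?_ h⟩
    exact FintypeCat.incl.map_injective (by simpa using h.w)
  simp only [key, Types.isPullback_iff]
  constructor
  · intro h
    refine ⟨?_, fun j x y hxy => ?_⟩
    · ext j x
      exact ConcreteCategory.congr_hom (h j).1 x
    · obtain ⟨z, hz⟩ := (h j).2.2 x y hxy
      exact ⟨z, hz, fun z' hz' => (h j).2.1 _ _ ⟨hz'.1.trans hz.1.symm, hz'.2.trans hz.2.symm⟩⟩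
  · rintro ⟨h, h'⟩ j
    refine ⟨?_, fun x y hxy => ?_, fun x y hxy => (h' j x y hxy).exists⟩
    · ext x
      exact ConcreteCategory.congr_hom (congr_app h j) x
    · exact (h' j (p.app j y) (q.app j y) (ConcreteCategory.congr_hom (congr_app h j) y)).unique
        hxy ⟨rfl, rfl⟩

/-- Coproducts are pointwise too. Unique existence over the sigma type packages joint surjectivity,
injectivity and disjointness of the images. -/
theorem nonempty_isColimit_cofan_iff {ι : Type w} [Finite ι] {X : ι → J ⥤ FintypeCat.{u}}
    {P : J ⥤ FintypeCat.{u}} (inj : ∀ i, X i ⟶ P) :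
    Nonempty (IsColimit (Cofan.mk P inj)) ↔
      ∀ (j : J) (p : P.obj j), ∃! z : Σ i, (X i).obj j, (inj z.1).app j z.2 = p := by
  have key (j : J) : Nonempty (IsColimit (Cofan.mk (FintypeCat.incl.obj (P.obj j))
      fun i => FintypeCat.incl.map ((inj i).app j))) ↔
      ∀ p : P.obj j, ∃! z : Σ i, (X i).obj j, (inj z.1).app j z.2 = p := by
    rw [Cofan.nonempty_isColimit_iff_bijective_fromSigma, Function.bijective_iff_existsUnique]
    rfl
  simp only [← key]
  constructor
  · rintro ⟨h⟩ j
    exact ⟨isColimitMapCoconeCofanMkEquiv FintypeCat.incl _ _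
      (isColimitOfPreserves FintypeCat.incl (isColimitMapCoconeCofanMkEquiv
        ((evaluation J FintypeCat).obj j) _ _ (isColimitOfPreserves _ h)))⟩
  · intro h
    exact ⟨evaluationJointlyReflectsColimits _ fun j => (isColimitMapCoconeCofanMkEquiv
      ((evaluation J FintypeCat).obj j) _ _).symm (isColimitOfReflects FintypeCat.incl
        ((isColimitMapCoconeCofanMkEquiv FintypeCat.incl _ _).symm (h j).some))⟩

theorem epi_iff_surjective_app {X Y : J ⥤ FintypeCat.{u}} (f : X ⟶ Y) :
    Epi f ↔ ∀ (j : J) (y : Y.obj j), ∃ x, f.app j x = y := by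
  rw [NatTrans.epi_iff_epi_app]
  refine forall_congr' fun j => ?_
  change _ ↔ Function.Surjective (FintypeCat.incl.map (f.app j))
  rw [← epi_iff_surjective]
  exact ⟨fun h => inferInstance, fun h => FintypeCat.incl.epi_of_epi_map h⟩

end FunctorToFintypeCat

/-- Every diagram on `Discrete (Fin n)` is isomorphic to one given by a family, and its cocones are
cofans, so cofans suffice as a test. -/
theorem CategoryTheory.Limits.preservesFiniteCoproducts_of_isColimit_cofan {C D : Type*}
    [Category* C] [Category* D] (F : C ⥤ D) (H : ∀ (n : ℕ) (X : Fin n → C) (P : C) (inj : ∀ i, X i ⟶ P),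
      IsColimit (Cofan.mk P inj) →
        Nonempty (IsColimit (Cofan.mk (F.obj P) fun i => F.map (inj i)))) :
    PreservesFiniteCoproducts F where
  preserves n := by
    suffices h : ∀ X : Fin n → C, PreservesColimit (Discrete.functor X) F from
      ⟨fun {K} => preservesColimit_of_iso_diagram _ Discrete.natIsoFunctor.symm⟩
    refine fun X => ⟨fun {c} hc => ?_⟩
    have e : c ≅ Cofan.mk c.pt (Cofan.inj c) := Cocone.ext (Iso.refl _) (by simp [Cofan.inj])
    obtain ⟨h⟩ := H n X c.pt (Cofan.inj c) (hc.ofIsoColimit e)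
    exact ⟨((isColimitMapCoconeCofanMkEquiv F _ _).symm h).ofIsoColimit
      ((Cocone.functoriality _ F).mapIso e.symm)⟩

/-! ### The functor `p_! q^*` of a span -/

namespace BurnSpan

variable {𝒢 ℋ 𝒥 : FinGrpd.{u}}

/-- The elements over `g` of the value at `X` of the functor `p_! q^*` attached to the span
`𝒢 ←p 𝒦 →q ℋ`: an object `k` of the fibre of `p` over `g`, and an element of `X (q k)`. -/
structure FibreElt (S : BurnSpan 𝒢 ℋ) (X : ℋ.carrier ⥤ FintypeCat.{u}) (g : 𝒢.carrier) :
    Type u where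
  /-- the object of the apex -/
  pt : S.apex.carrier
  eq : S.left.obj pt = g
  /-- the element over that object -/
  val : (X.obj (S.right.obj pt)).obj

namespace FibreElt

variable {S : BurnSpan 𝒢 ℋ} {X Y : ℋ.carrier ⥤ FintypeCat.{u}} {g g' g'' : 𝒢.carrier}

instance : Finite (FibreElt S X g) :=
  Finite.of_injective
    (fun x => (⟨x.pt, x.val⟩ : Σ k : S.apex.carrier, (X.obj (S.right.obj k)).obj)) fun x y h => by
      cases x; cases y; cases h; rfl

theorem mk_inj_iff {k : S.apex.carrier} {h h' : S.left.obj k = g}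
    {x y : (X.obj (S.right.obj k)).obj} : (⟨k, h, x⟩ : FibreElt S X g) = ⟨k, h', y⟩ ↔ x = y := by
  simp

/-- A morphism lying over an identity is itself an `eqToHom`, by uniqueness of lifts. Elements can
thus be compared along morphisms of the apex instead of equalities of objects. -/
theorem ext_of_hom {x y : FibreElt S X g} (a : x.pt ⟶ y.pt)
    (ha : S.left.map a = eqToHom (x.eq.trans y.eq.symm))
    (h : X.map (S.right.map a) x.val = y.val) : x = y := by
  obtain ⟨k, hk, x⟩ := x
  obtain ⟨l, hl, y⟩ := y
  obtain ⟨e, he⟩ := S.fib.faithful (𝟙 _) a (hk.trans hl.symm) (by simp [ha])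
  dsimp at e
  subst e
  obtain rfl : 𝟙 k = a := by simpa using he
  rw [mk_inj_iff]
  simpa using h

/-- Transport of elements along a morphism, given by lifting that morphism along the discrete
fibration. -/
noncomputable def transport (f : g ⟶ g') (x : FibreElt S X g) : FibreElt S X g' where
  pt := S.fib.liftObj x.pt (eqToHom x.eq ≫ f)
  eq := S.fib.obj_liftObj _ _
  val := X.map (S.right.map (S.fib.lift x.pt (eqToHom x.eq ≫ f))) x.val

/-- The lift of a morphism that gives the transport along it. -/
noncomputable def transportHom (f : g ⟶ g') (x : FibreElt S X g) : x.pt ⟶ (transport f x).pt :=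
  S.fib.lift x.pt (eqToHom x.eq ≫ f)

theorem map_transportHom (f : g ⟶ g') (x : FibreElt S X g) :
    S.left.map (transportHom f x) = eqToHom x.eq ≫ f ≫ eqToHom (transport f x).eq.symm :=
  (S.fib.map_lift x.pt (eqToHom x.eq ≫ f)).trans (Category.assoc _ _ _)

theorem transport_val (f : g ⟶ g') (x : FibreElt S X g) :
    (transport f x).val = X.map (S.right.map (transportHom f x)) x.val := rfl

/-- Any lift of `f` computes the transport, not only the chosen one: the inverse of the chosen lift
followed by `a` lies over an identity. This is the tool for every compatibility with transport
below. -/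
theorem transport_eq (f : g ⟶ g') {x : FibreElt S X g} {y : FibreElt S X g'} (a : x.pt ⟶ y.pt)
    (ha : S.left.map a = eqToHom x.eq ≫ f ≫ eqToHom y.eq.symm)
    (h : X.map (S.right.map a) x.val = y.val) : transport f x = y := by
  refine ext_of_hom (Groupoid.inv (transportHom f x) ≫ a) ?_ ?_
  · simp [map_transportHom, ha]
  · rw [← h, transport_val, ← FintypeCat.comp_apply, ← X.map_comp, ← S.right.map_comp]
    simp

theorem transport_id (x : FibreElt S X g) : transport (𝟙 g) x = x :=
  transport_eq (𝟙 g) (𝟙 x.pt) (by simp) (by simp)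

theorem transport_comp (f : g ⟶ g') (f' : g' ⟶ g'') (x : FibreElt S X g) :
    transport (f ≫ f') x = transport f' (transport f x) :=
  transport_eq (f ≫ f') (transportHom f x ≫ transportHom f' (transport f x))
    (by simp [map_transportHom]) (by simp [transport_val])

/-- The map induced by a natural transformation. -/
@[simps] def mapNat (φ : X ⟶ Y) (x : FibreElt S X g) : FibreElt S Y g where
  pt := x.pt
  eq := x.eq
  val := φ.app _ x.val

theorem transport_mapNat (φ : X ⟶ Y) (f : g ⟶ g') (x : FibreElt S X g) :
    transport f (mapNat φ x) = mapNat φ (transport f x) :=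
  transport_eq f (transportHom f x) (map_transportHom f x)
    (FunctorToFintypeCat.naturality _ _ φ _ x.val).symm

end FibreElt

open FibreElt

/-- The functor `p_! q^* X` for a functor `X : ℋ ⥤ Fin` and a span `𝒢 ←p 𝒦 →q ℋ`. -/
@[simps] noncomputable def pushPull (S : BurnSpan 𝒢 ℋ) (X : ℋ.carrier ⥤ FintypeCat.{u}) :
    𝒢.carrier ⥤ FintypeCat.{u} where
  obj g := FintypeCat.of (FibreElt S X g)
  map f := FintypeCat.homMk (transport f)
  map_id _ := FintypeCat.hom_ext _ _ transport_id
  map_comp f f' := FintypeCat.hom_ext _ _ (transport_comp f f')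

/-- The functor `p_! q^* : Fin_ℋ ⥤ Fin_𝒢` attached to a span `𝒢 ←p 𝒦 →q ℋ`. -/
@[simps] noncomputable def functorOf (S : BurnSpan 𝒢 ℋ) :
    (ℋ.carrier ⥤ FintypeCat.{u}) ⥤ (𝒢.carrier ⥤ FintypeCat.{u}) where
  obj X := S.pushPull X
  map φ :=
    { app := fun _ => FintypeCat.homMk (mapNat φ)
      naturality := fun _ _ f => FintypeCat.hom_ext _ _ fun x => (transport_mapNat φ f x).symm }
  map_id _ := rfl
  map_comp _ _ := rfl

/-- Induced maps leave the fibre point `k` unchanged, so a compatible pair of elements shares its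
`k`, and the question reduces to the given pullback evaluated at `q k`. -/
theorem preservesPullbacks_functorOf (S : BurnSpan 𝒢 ℋ) :
    PreservesLimitsOfShape WalkingCospan (functorOf S) := by
  refine preservesLimitsOfShape_walkingCospan_of_forall_isPullback fun X Y Z f g _ =>
    ⟨pullback f g, pullback.fst f g, pullback.snd f g, .of_hasPullback f g, ?_⟩
  have h := (isPullback_iff_exists_unique _ _ _ _).1 (IsPullback.of_hasPullback f g)
  rw [isPullback_iff_exists_unique]
  refine ⟨by rw [← Functor.map_comp, ← Functor.map_comp, h.1], fun j => ?_⟩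
  rintro (⟨k, hk, x⟩ : FibreElt S X j) (⟨l, hl, y⟩ : FibreElt S Y j)
    (hxy : mapNat f _ = mapNat g _)
  obtain rfl : k = l := congrArg FibreElt.pt hxy
  obtain ⟨z, ⟨rfl, rfl⟩, hz'⟩ := h.2 _ x y (mk_inj_iff.1 hxy)
  refine ⟨(⟨k, hk, z⟩ : FibreElt S _ j), ⟨rfl, rfl⟩, ?_⟩
  rintro (⟨l, hl, z'⟩ : FibreElt S _ j) ⟨h₁ : mapNat _ _ = _, h₂ : mapNat _ _ = _⟩
  obtain rfl : l = k := congrArg FibreElt.pt h₁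
  exact mk_inj_iff.2 (hz' z' ⟨mk_inj_iff.1 h₁, mk_inj_iff.1 h₂⟩)

theorem preservesFiniteCoproducts_functorOf (S : BurnSpan 𝒢 ℋ) :
    PreservesFiniteCoproducts (functorOf S) := by
  refine preservesFiniteCoproducts_of_isColimit_cofan _ fun n X P inj hc => ?_
  have h := (nonempty_isColimit_cofan_iff _).1 ⟨hc⟩
  rw [nonempty_isColimit_cofan_iff]
  rintro j (⟨k, hk, x⟩ : FibreElt S P j)
  obtain ⟨⟨i, z⟩, rfl, hz'⟩ := h _ x
  refine ⟨⟨i, (⟨k, hk, z⟩ : FibreElt S _ j)⟩, rfl, ?_⟩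
  rintro ⟨i', (⟨l, hl, z'⟩ : FibreElt S _ j)⟩ (h₁ : mapNat _ _ = _)
  obtain rfl : l = k := congrArg FibreElt.pt h₁
  cases hz' ⟨i', z'⟩ (mk_inj_iff.1 h₁)
  rfl

theorem preservesEpimorphisms_functorOf (S : BurnSpan 𝒢 ℋ) :
    (functorOf S).PreservesEpimorphisms where
  preserves f hf := by
    rw [epi_iff_surjective_app] at hf ⊢
    rintro j (⟨k, hk, y⟩ : FibreElt S _ j)
    obtain ⟨x, rfl⟩ := hf _ y
    exact ⟨(⟨k, hk, x⟩ : FibreElt S _ j), rfl⟩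

theorem isPCE_functorOf (S : BurnSpan 𝒢 ℋ) :
    CatPCE.IsPCE ℋ.finCat 𝒢.finCat (functorOf S) :=
  ⟨preservesPullbacks_functorOf S, preservesFiniteCoproducts_functorOf S,
    preservesEpimorphisms_functorOf S⟩

/-- The map on elements induced by a map of spans. -/
@[simps] def FibreElt.mapSpan {S T : BurnSpan 𝒢 ℋ} (η : S ⟶ T) {X : ℋ.carrier ⥤ FintypeCat.{u}}
    {g : 𝒢.carrier} (x : FibreElt S X g) : FibreElt T X g where
  pt := η.functor.obj x.pt
  eq := (η.obj_eq x.pt).trans x.eq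
  val := X.map (η.iso.app x.pt) x.val

/-- The functor of `η` commutes with the left legs, hence sends lifts to lifts. Naturality of
`η.iso` matches the values. -/
theorem FibreElt.transport_mapSpan {S T : BurnSpan 𝒢 ℋ} (η : S ⟶ T)
    {X : ℋ.carrier ⥤ FintypeCat.{u}} {g g' : 𝒢.carrier} (f : g ⟶ g') (x : FibreElt S X g) :
    transport f (mapSpan η x) = mapSpan η (transport f x) := by
  have h₁ : T.left.map (η.functor.map (transportHom f x)) =
      eqToHom ((η.obj_eq x.pt).trans x.eq) ≫ f ≫
        eqToHom ((η.obj_eq _).trans (transport f x).eq).symm := by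
    rw [η.map_eq, map_transportHom]
    simp
  have h₂ : X.map (T.right.map (η.functor.map (transportHom f x))) (X.map (η.iso.app x.pt) x.val) =
      X.map (η.iso.app (transport f x).pt) (X.map (S.right.map (transportHom f x)) x.val) := by
    have h := η.iso.naturality (transportHom f x)
    dsimp only [Functor.comp_map] at h
    rw [← FintypeCat.comp_apply, ← FintypeCat.comp_apply, ← X.map_comp, ← X.map_comp, h]
  exact transport_eq f (η.functor.map (transportHom f x)) h₁ h₂

/-- The natural transformation induced by a map of spans. -/
noncomputable def natOf {S T : BurnSpan 𝒢 ℋ} (η : S ⟶ T) : functorOf S ⟶ functorOf T where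
  app X :=
    { app := fun _ => FintypeCat.homMk (mapSpan η)
      naturality := fun _ _ f => FintypeCat.hom_ext _ _ fun x => (transport_mapSpan η f x).symm }
  naturality X Y φ := by
    ext g (x : FibreElt S X g)
    exact mk_inj_iff.2 (FunctorToFintypeCat.naturality _ _ φ _ x.val).symm

@[simp] theorem natOf_app_app {S T : BurnSpan 𝒢 ℋ} (η : S ⟶ T) (X : ℋ.carrier ⥤ FintypeCat.{u})
    {g : 𝒢.carrier} (x : FibreElt S X g) : ((natOf η).app X).app g x = mapSpan η x := rfl

theorem FibreElt.mapSpan_id {S : BurnSpan 𝒢 ℋ} {X : ℋ.carrier ⥤ FintypeCat.{u}}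
    {g : 𝒢.carrier} (x : FibreElt S X g) : mapSpan (𝟙 S) x = x := by
  obtain ⟨k, hk, x⟩ := x
  exact mk_inj_iff.2 (ConcreteCategory.congr_hom (X.map_id _) x)

theorem FibreElt.mapSpan_comp {S T U : BurnSpan 𝒢 ℋ} (η : S ⟶ T) (θ : T ⟶ U)
    {X : ℋ.carrier ⥤ FintypeCat.{u}} {g : 𝒢.carrier} (x : FibreElt S X g) :
    mapSpan (η ≫ θ) x = mapSpan θ (mapSpan η x) :=
  mk_inj_iff.2 (ConcreteCategory.congr_hom (X.map_comp _ _) x.val)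

theorem natOf_id (S : BurnSpan 𝒢 ℋ) : natOf (𝟙 S) = 𝟙 (functorOf S) := by
  ext X g x
  exact mapSpan_id x

theorem natOf_comp {S T U : BurnSpan 𝒢 ℋ} (η : S ⟶ T) (θ : T ⟶ U) :
    natOf (η ≫ θ) = natOf η ≫ natOf θ := by
  ext X g x
  exact mapSpan_comp η θ x

/-- The elements for the identity span. -/
def FibreElt.idEquiv (X : 𝒢.carrier ⥤ FintypeCat.{u}) (g : 𝒢.carrier) :
    FibreElt (idSpan 𝒢) X g ≃ (X.obj g).obj where
  toFun x := X.map (eqToHom x.eq) x.val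
  invFun x := ⟨g, rfl, x⟩
  left_inv := by
    rintro ⟨k, hk, x⟩
    dsimp at hk
    subst hk
    simp
  right_inv x := by simp

theorem FibreElt.transport_idEquiv_symm (X : 𝒢.carrier ⥤ FintypeCat.{u}) {g g' : 𝒢.carrier}
    (f : g ⟶ g') (x : (X.obj g).obj) :
    transport f ((idEquiv X g).symm x) = (idEquiv X g').symm (X.map f x) := by
  have h : f = eqToHom rfl ≫ f ≫ eqToHom rfl := by simp
  exact transport_eq (S := idSpan 𝒢) f f h rfl

theorem FibreElt.idEquiv_transport (X : 𝒢.carrier ⥤ FintypeCat.{u}) {g g' : 𝒢.carrier}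
    (f : g ⟶ g') (x : FibreElt (idSpan 𝒢) X g) :
    idEquiv X g' (transport f x) = X.map f (idEquiv X g x) := by
  rw [← Equiv.eq_symm_apply, ← transport_idEquiv_symm, Equiv.symm_apply_apply]

theorem FibreElt.idEquiv_mapNat {X Y : 𝒢.carrier ⥤ FintypeCat.{u}} (φ : X ⟶ Y) {g : 𝒢.carrier}
    (x : FibreElt (idSpan 𝒢) X g) : idEquiv Y g (mapNat φ x) = φ.app g (idEquiv X g x) :=
  (FunctorToFintypeCat.naturality _ _ φ (eqToHom x.eq) x.val).symm

/-- The elements for a composite of spans. -/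
def FibreElt.compEquiv (S : BurnSpan 𝒢 ℋ) (T : BurnSpan ℋ 𝒥) (X : 𝒥.carrier ⥤ FintypeCat.{u})
    (g : 𝒢.carrier) :
    FibreElt (compSpan S T) X g ≃ FibreElt S (pushPull T X) g where
  toFun x := ⟨StrictPullback.fst x.pt, x.eq, ⟨StrictPullback.snd x.pt, x.pt.eq.symm, x.val⟩⟩
  invFun x := ⟨⟨x.pt, FibreElt.pt x.val, (FibreElt.eq x.val).symm⟩, x.eq, FibreElt.val x.val⟩

/-- A lift in the pullback consists of a lift of `f` to the first apex and a lift of its image in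
`ℋ` to the second, so `transport_eq` applies once on each level. -/
theorem FibreElt.compEquiv_transport (S : BurnSpan 𝒢 ℋ) (T : BurnSpan ℋ 𝒥)
    (X : 𝒥.carrier ⥤ FintypeCat.{u}) {g g' : 𝒢.carrier} (f : g ⟶ g')
    (x : FibreElt (compSpan S T) X g) :
    compEquiv S T X g' (transport f x) = transport f (compEquiv S T X g x) := by
  refine (transport_eq f (StrictPullback.Hom.fst (transportHom f x)) (map_transportHom f x)
    (transport_eq _ (StrictPullback.Hom.snd (transportHom f x)) ?_ rfl)).symm
  -- The compatibility of the two components says that the second lifts the image of the first.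
  have h := StrictPullback.Hom.w (transportHom f x)
  exact ((eqToHom_comp_iff _ _ _).1 h.symm).trans rfl

/-- The functor attached to the identity span is the identity. -/
noncomputable def functorOfId (𝒢 : FinGrpd.{u}) : functorOf (idSpan 𝒢) ≅ 𝟭 _ :=
  NatIso.ofComponents (fun X => NatIso.ofComponents
    (fun g => FintypeCat.equivEquivIso (FibreElt.idEquiv X g)) (fun {g g'} f => by
      ext (x : FibreElt (idSpan 𝒢) X g)
      exact FibreElt.idEquiv_transport X f x)) (fun {X Y} φ => by
      ext g (x : FibreElt (idSpan 𝒢) X g)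
      exact FibreElt.idEquiv_mapNat φ x)

/-- The functor attached to a composite of spans is the composite of the functors. -/
noncomputable def functorOfComp (S : BurnSpan 𝒢 ℋ) (T : BurnSpan ℋ 𝒥) :
    functorOf (compSpan S T) ≅ functorOf T ⋙ functorOf S :=
  NatIso.ofComponents (fun X => NatIso.ofComponents
    (fun g => FintypeCat.equivEquivIso (FibreElt.compEquiv S T X g)) (fun {g g'} f => by
      ext (x : FibreElt (compSpan S T) X g)
      exact FibreElt.compEquiv_transport S T X f x)) (fun {X Y} φ => by
      ext g (x : FibreElt (compSpan S T) X g)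
      rfl)

end BurnSpan

/-! ### The pseudofunctor from spans to functors -/

open BurnSpan FibreElt Bicategory

/-- The object `Fin_𝒢` of the full sub-2-category. -/
noncomputable def FinSub.of (𝒢 : FinGrpd.{u}) : FinSub.{u} :=
  (⟨𝒢.finCat, 𝒢, rfl⟩ : Set.range FinGrpd.finCat.{u})

namespace FinSub

variable {𝒢 ℋ : FinGrpd.{u}}

/-- The functor underlying a 1-morphism. -/
noncomputable abbrev functor (F : FinSub.of ℋ ⟶ FinSub.of 𝒢) :
    (ℋ.carrier ⥤ FintypeCat.{u}) ⥤ (𝒢.carrier ⥤ FintypeCat.{u}) :=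
  F.hom.obj

/-- The natural transformation underlying a 2-morphism. -/
noncomputable abbrev natTrans {F G : FinSub.of ℋ ⟶ FinSub.of 𝒢} (η : F ⟶ G) : functor F ⟶ functor G :=
  CatPCE.nat η.hom

theorem hom₂_ext {F G : FinSub.of ℋ ⟶ FinSub.of 𝒢} {η θ : F ⟶ G}
    (h : ∀ X g (x : (((functor F).obj X).obj g).obj),
      ((natTrans η).app X).app g x = ((natTrans θ).app X).app g x) : η = θ := by
  refine InducedBicategory.hom₂_ext (CatPCE.hom₂_ext fun X => ?_)
  change (natTrans η).app X = (natTrans θ).app X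
  ext g x
  exact h X g x

end FinSub

/-- The 1-morphism `Fin_ℋ ⟶ Fin_𝒢` attached to a span from `𝒢` to `ℋ`. -/
noncomputable def BurnSpan.toFinSub {𝒢 ℋ : FinGrpd.{u}} (S : BurnSpan 𝒢 ℋ) :
    FinSub.of ℋ ⟶ FinSub.of 𝒢 :=
  InducedBicategory.mkHom (⟨functorOf S, isPCE_functorOf S⟩ : ℋ.finCat ⟶ 𝒢.finCat)

/-- The 2-morphism attached to a map of spans. -/
noncomputable def BurnSpan.toFinSubMap {𝒢 ℋ : FinGrpd.{u}} {S T : BurnSpan 𝒢 ℋ} (η : S ⟶ T) :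
    S.toFinSub ⟶ T.toFinSub :=
  InducedBicategory.Hom₂.mk (CatPCE.ofNat (natOf η))

theorem BurnSpan.FibreElt.transport_eqToHom {𝒢 ℋ : FinGrpd.{u}} {S : BurnSpan 𝒢 ℋ}
    {X : ℋ.carrier ⥤ FintypeCat.{u}} {g g' : 𝒢.carrier} (h : g = g') (x : FibreElt S X g) :
    transport (eqToHom h) x = ⟨x.pt, x.eq.trans h, x.val⟩ := by
  subst h
  exact transport_id x

/-- This is the coherence law for the right unitor of the pseudofunctor, as the opposite exchanges
the unitors. The element lies over some `g'` equal to `g`, and transport along that equality changes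
only the proof component. -/
theorem BurnSpan.FibreElt.mapSpan_leftUnitor {𝒢 ℋ : FinGrpd.{u}} (S : BurnSpan 𝒢 ℋ)
    {X : ℋ.carrier ⥤ FintypeCat.{u}} {g : 𝒢.carrier} (x : FibreElt (compSpan (idSpan 𝒢) S) X g) :
    mapSpan (leftUnitor S).hom x = idEquiv (pushPull S X) g (compEquiv (idSpan 𝒢) S X g x) := by
  obtain ⟨⟨g', k, e⟩, h, v⟩ := x
  refine Eq.trans ?_ (transport_eqToHom h (⟨k, e.symm, v⟩ : FibreElt S X g')).symm
  exact mk_inj_iff.2 (ConcreteCategory.congr_hom (X.map_id _) v)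

open Bicategory.Opposite in
/-- The pseudofunctor that sends a finite groupoid `𝒢` to `Fin_𝒢` and a span `𝒢 ←p 𝒦 →q ℋ` to the
functor `p_! q^*`. -/
noncomputable def finPseudofunctor : Pseudofunctor BurnGlo.{u}ᵒᵖ FinSub.{u} where
  obj a := FinSub.of a.unop.grpd
  map f := BurnSpan.toFinSub f.unop
  map₂ η := BurnSpan.toFinSubMap (Hom2.unop2 η)
  map₂_id f := InducedBicategory.hom₂_ext (congrArg CatPCE.ofNat (natOf_id f.unop))
  map₂_comp η θ := InducedBicategory.hom₂_ext
    (congrArg CatPCE.ofNat (natOf_comp (Hom2.unop2 η) (Hom2.unop2 θ)))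
  mapId a := InducedBicategory.isoMk (CatPCE.ofNatIso (functorOfId a.unop.grpd))
  mapComp f g := InducedBicategory.isoMk (CatPCE.ofNatIso (functorOfComp g.unop f.unop))
  -- The opposite turns this into right whiskering of spans, which uses the same chosen lift of the
  -- same morphism as `transport` does; the two sides therefore agree definitionally on elements.
  map₂_whisker_left _ _ _ _ :=
    FinSub.hom₂_ext fun _ _ _ => rfl
  map₂_whisker_right _ _ :=
    FinSub.hom₂_ext fun _ _ _ => rfl
  map₂_associator _ _ _ := FinSub.hom₂_ext fun X _ x =>
    mk_inj_iff.2 (ConcreteCategory.congr_hom (X.map_id _) (FibreElt.val x))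
  map₂_left_unitor _ :=
    FinSub.hom₂_ext fun _ _ _ => rfl
  map₂_right_unitor f := FinSub.hom₂_ext fun _ _ x => FibreElt.mapSpan_leftUnitor f.unop x

/-! ### Representable functors and the Yoneda lemma -/

section Representable

variable {𝒢 : FinGrpd.{u}}

/-- The functor represented by an object of a finite groupoid. -/
@[simps] def FinGrpd.rep (g : 𝒢.carrier) : 𝒢.carrier ⥤ FintypeCat.{u} where
  obj g' := FintypeCat.of (g ⟶ g')
  map f := FintypeCat.homMk fun a => a ≫ f

/-- The natural transformation corresponding to an element under the Yoneda lemma. -/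
@[simps] def FinGrpd.repHom {g : 𝒢.carrier} {X : 𝒢.carrier ⥤ FintypeCat.{u}} (x : (X.obj g).obj) :
    rep g ⟶ X where
  app g' := FintypeCat.homMk fun a : g ⟶ g' => X.map a x
  naturality g' g'' f := by
    ext (a : g ⟶ g')
    exact ConcreteCategory.congr_hom (X.map_comp a f) x

theorem FinGrpd.repHom_app_id {g : 𝒢.carrier} {X : 𝒢.carrier ⥤ FintypeCat.{u}}
    (x : (X.obj g).obj) : (repHom x).app g (𝟙 g : g ⟶ g) = x :=
  ConcreteCategory.congr_hom (X.map_id g) x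

theorem FinGrpd.repHom_comp {g : 𝒢.carrier} {X Y : 𝒢.carrier ⥤ FintypeCat.{u}}
    (x : (X.obj g).obj) (φ : X ⟶ Y) : repHom x ≫ φ = repHom (φ.app g x) := by
  ext g' (a : g ⟶ g')
  exact FunctorToFintypeCat.naturality _ _ φ a x

theorem FinGrpd.repHom_id (g : 𝒢.carrier) :
    repHom (X := rep g) (𝟙 g : g ⟶ g) = 𝟙 (rep g) := by
  ext g' (a : g ⟶ g')
  exact Category.id_comp a

end Representable

/-! ### Natural transformations come from unique maps of spans -/

namespace IsDiscreteFibration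

theorem map_injective {G H : Type*} [Groupoid G] [Groupoid H] {F : H ⥤ G}
    (hF : IsDiscreteFibration F) {x y : H} {a b : x ⟶ y} (h : F.map a = F.map b) : a = b := by
  obtain ⟨_, he⟩ := hF.faithful a b rfl (by simpa using h)
  simpa using he

end IsDiscreteFibration

namespace BurnSpan

open FibreElt FinGrpd

variable {𝒢 ℋ : FinGrpd.{u}} {S T : BurnSpan 𝒢 ℋ}

/-- Converse to `transport_eq`: it extracts a morphism of the apex from an equality of elements. -/
theorem FibreElt.exists_hom_of_transport_eq {X : ℋ.carrier ⥤ FintypeCat.{u}} {g g' : 𝒢.carrier}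
    {f : g ⟶ g'} {x : FibreElt S X g} {y : FibreElt S X g'} (h : transport f x = y) :
    ∃ a : x.pt ⟶ y.pt, S.left.map a = eqToHom x.eq ≫ f ≫ eqToHom y.eq.symm ∧
      X.map (S.right.map a) x.val = y.val := by
  subst h
  exact ⟨transportHom f x, map_transportHom f x, rfl⟩

theorem FibreElt.exists_hom_of_eq {X : ℋ.carrier ⥤ FintypeCat.{u}} {g : 𝒢.carrier}
    {x y : FibreElt S X g} (h : x = y) :
    ∃ a : x.pt ⟶ y.pt, S.left.map a = eqToHom (x.eq.trans y.eq.symm) ∧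
      X.map (S.right.map a) x.val = y.val := by
  subst h
  exact ⟨𝟙 _, by simp, by simp⟩

/-- The universal element over an object of the apex. -/
@[simps] def univElt (S : BurnSpan 𝒢 ℋ) (k : S.apex.carrier) :
    FibreElt S (rep (S.right.obj k)) (S.left.obj k) where
  pt := k
  eq := rfl
  val := 𝟙 (S.right.obj k)

/-- On the universal element over `k`, the transformation of `η` returns `η k` together with the
component of `η.iso`. Equality of these values yields the morphism over an identity that
`hom_ext_of` asks for. -/
theorem natOf_injective {η θ : S ⟶ T} (h : natOf η = natOf θ) : η = θ := by
  have key (k : S.apex.carrier) : ∃ a : η.functor.obj k ⟶ θ.functor.obj k,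
      T.left.map a = eqToHom ((η.obj_eq k).trans (θ.obj_eq k).symm) ∧
        (𝟙 _ ≫ η.iso.app k) ≫ T.right.map a = 𝟙 _ ≫ θ.iso.app k :=
    exists_hom_of_eq (x := mapSpan η (univElt S k)) (y := mapSpan θ (univElt S k))
      (by rw [← natOf_app_app, ← natOf_app_app, h])
  choose a ha ha' using key
  exact hom_ext_of a ha fun k => by simpa using ha' k

section

variable (φ : functorOf S ⟶ functorOf T)

/-- The image of the universal element. -/
noncomputable def imgElt (k : S.apex.carrier) :
    FibreElt T (rep (S.right.obj k)) (S.left.obj k) :=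
  (φ.app _).app _ (univElt S k)

/-- The component of a natural transformation that is the value on the universal element. -/
noncomputable def imgHom (k : S.apex.carrier) : S.right.obj k ⟶ T.right.obj (imgElt φ k).pt :=
  (imgElt φ k).val

/-- An element `(k, v)` is the image of the universal element over `k` under the map `repHom v`, so
naturality in `X` determines `φ` on it. -/
theorem app_app_eq {X : ℋ.carrier ⥤ FintypeCat.{u}} {g : 𝒢.carrier} (x : FibreElt S X g) :
    (φ.app X).app g x = (⟨(imgElt φ x.pt).pt, (imgElt φ x.pt).eq.trans x.eq,
      X.map (imgHom φ x.pt) x.val⟩ : FibreElt T X g) := by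
  obtain ⟨k, rfl, v⟩ := x
  have h : (⟨k, rfl, v⟩ : FibreElt S X (S.left.obj k)) = mapNat (repHom v) (univElt S k) :=
    mk_inj_iff.2 (repHom_app_id v).symm
  exact (congrArg ((φ.app X).app (S.left.obj k)) h).trans (ConcreteCategory.congr_hom
    (congr_app (φ.naturality (repHom v)) (S.left.obj k)) (univElt S k))

/-- This provides the action on morphisms of the functor underlying `homOfNat`. The universal
element over `k`, transported along the image of `a`, becomes `(l, q a)`; naturality of `φ` in `𝒢`
compares the images, and the resulting equality of elements gives `b`. -/
theorem exists_hom_imgElt {k l : S.apex.carrier} (a : k ⟶ l) :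
    ∃ b : (imgElt φ k).pt ⟶ (imgElt φ l).pt,
      T.left.map b = eqToHom (imgElt φ k).eq ≫ S.left.map a ≫ eqToHom (imgElt φ l).eq.symm ∧
        imgHom φ k ≫ T.right.map b = S.right.map a ≫ imgHom φ l := by
  let y : FibreElt S (rep (S.right.obj k)) (S.left.obj l) := ⟨l, rfl, S.right.map a⟩
  have h₁ : transport (S.left.map a) (univElt S k) = y :=
    transport_eq _ a (show S.left.map a = 𝟙 _ ≫ S.left.map a ≫ 𝟙 _ by simp)
      (Category.id_comp (S.right.map a))
  have h₂ : transport (S.left.map a) (imgElt φ k) = (φ.app _).app _ y := by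
    rw [← h₁]
    exact (FunctorToFintypeCat.naturality _ _ (φ.app _) (S.left.map a) (univElt S k)).symm
  rw [app_app_eq] at h₂
  exact exists_hom_of_transport_eq h₂

/-- The map of spans corresponding to a natural transformation. -/
noncomputable def homOfNat : S ⟶ T :=
  Hom.mk
    { obj := fun k => (imgElt φ k).pt
      map := fun a => (exists_hom_imgElt φ a).choose
      -- The morphisms are chosen, but a discrete fibration is faithful, so the functor laws can be
      -- checked after applying `T.left`.
      map_id := fun k => T.fib.map_injective (by
        rw [(exists_hom_imgElt φ (𝟙 k)).choose_spec.1]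
        simp)
      map_comp := fun a b => T.fib.map_injective (by
        rw [(exists_hom_imgElt φ (a ≫ b)).choose_spec.1, T.left.map_comp,
          (exists_hom_imgElt φ a).choose_spec.1, (exists_hom_imgElt φ b).choose_spec.1]
        simp) }
    (CategoryTheory.Functor.ext (fun k => (imgElt φ k).eq)
      fun _ _ a => (exists_hom_imgElt φ a).choose_spec.1)
    { app := imgHom φ
      naturality := fun _ _ a => (exists_hom_imgElt φ a).choose_spec.2.symm }

theorem natOf_homOfNat : natOf (homOfNat φ) = φ := by
  ext X g x
  exact (app_app_eq φ x).symm

end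

end BurnSpan

/-! ### The point and categories of elements -/

/-- The constant functor with value a point. -/
def FinGrpd.pt (𝒢 : FinGrpd.{u}) : 𝒢.carrier ⥤ FintypeCat.{u} :=
  (Functor.const _).obj (FintypeCat.of PUnit)

/-- The unique natural transformation to the constant functor with value a point. -/
def FinGrpd.toPt {𝒢 : FinGrpd.{u}} (X : 𝒢.carrier ⥤ FintypeCat.{u}) : X ⟶ 𝒢.pt where
  app _ := FintypeCat.homMk fun _ => PUnit.unit

theorem FinGrpd.hom_toPt {𝒢 : FinGrpd.{u}} {X Y : 𝒢.carrier ⥤ FintypeCat.{u}} (φ : X ⟶ Y) :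
    φ ≫ toPt Y = toPt X := rfl

/-- The category of elements of a functor to finite sets. -/
structure FinElements {𝒢 : FinGrpd.{u}} (T : 𝒢.carrier ⥤ FintypeCat.{u}) : Type u where
  /-- the object of the base -/
  base : 𝒢.carrier
  /-- the element -/
  elt : (T.obj base).obj

namespace FinElements

variable {𝒢 : FinGrpd.{u}} {T : 𝒢.carrier ⥤ FintypeCat.{u}}

instance : Groupoid.{u} (FinElements T) where
  Hom x y := { f : x.base ⟶ y.base // T.map f x.elt = y.elt }
  id x := ⟨𝟙 _, by simp⟩
  comp f g := ⟨f.1 ≫ g.1, by simp [f.2, g.2]⟩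
  inv {x y} f := ⟨Groupoid.inv f.1, by
    have h : T.map (Groupoid.inv f.1) (T.map f.1 x.elt) = x.elt := by
      rw [← FintypeCat.comp_apply, ← T.map_comp]
      simp
    rwa [f.2] at h⟩

instance : Finite (FinElements T) :=
  Finite.of_injective (fun x => (⟨x.base, x.elt⟩ : Σ g : 𝒢.carrier, (T.obj g).obj)) fun x y h => by
    cases x; cases y; cases h; rfl

instance (x y : FinElements T) : Finite (x ⟶ y) :=
  inferInstanceAs (Finite { f : x.base ⟶ y.base // T.map f x.elt = y.elt })

/-- The projection to the base. -/
@[simps] def proj (T : 𝒢.carrier ⥤ FintypeCat.{u}) : FinElements T ⥤ 𝒢.carrier where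
  obj x := x.base
  map f := f.1

theorem isDiscreteFibration_proj : IsDiscreteFibration (proj T) := by
  intro x g (f : x.base ⟶ g)
  refine ⟨⟨⟨g, T.map f x.elt⟩, ⟨f, rfl⟩⟩, ⟨rfl, Category.comp_id f⟩, ?_⟩
  rintro ⟨⟨g', t⟩, ⟨(a : x.base ⟶ g'), (ha : T.map a x.elt = t)⟩⟩ ⟨h, h'⟩
  dsimp at h
  subst h ha
  obtain rfl : a = f := (Category.comp_id a).symm.trans h'
  rfl

end FinElements

/-! ### Reconstructing a span from a functor -/

namespace PCEFunctor

open FinGrpd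

variable {𝒢 ℋ : FinGrpd.{u}}
  {F : (ℋ.carrier ⥤ FintypeCat.{u}) ⥤ (𝒢.carrier ⥤ FintypeCat.{u})}

section

variable (X : ℋ.carrier ⥤ FintypeCat.{u}) (h : ℋ.carrier)

/-- The morphism `(x, id)` from a representable functor to its product with `X`. -/
noncomputable def graph (x : (X.obj h).obj) : rep h ⟶ pullback (toPt X) (toPt (rep h)) :=
  pullback.lift (repHom x) (𝟙 _) ((hom_toPt _).trans (hom_toPt _).symm)

@[simp] theorem graph_fst (x : (X.obj h).obj) : graph X h x ≫ pullback.fst _ _ = repHom x :=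
  pullback.lift_fst _ _ _

@[simp] theorem graph_snd (x : (X.obj h).obj) : graph X h x ≫ pullback.snd _ _ = 𝟙 _ :=
  pullback.lift_snd _ _ _

/-- An element of the product at `h'` is a pair `(y, a)` with `a : h ⟶ h'`. As `a` is invertible, it
lies on the graph of exactly one `x`. The product is written as a pullback over the point because
`F` need not preserve the terminal object. -/
theorem isColimit_graph :
    Nonempty (IsColimit (Cofan.mk (pullback (toPt X) (toPt (rep h))) (graph X h))) := by
  rw [nonempty_isColimit_cofan_iff]
  intro h' p
  have H := ((isPullback_iff_exists_unique _ _ _ _).1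
    (IsPullback.of_hasPullback (toPt X) (toPt (rep h)))).2 h'
  have h₁ (x : (X.obj h).obj) (a : h ⟶ h') :
      (pullback.fst (toPt X) (toPt (rep h))).app h' ((graph X h x).app h' a) = X.map a x :=
    ConcreteCategory.congr_hom (congr_app (graph_fst X h x) h') a
  have h₂ (x : (X.obj h).obj) (a : h ⟶ h') :
      (pullback.snd (toPt X) (toPt (rep h))).app h' ((graph X h x).app h' a) = a :=
    ConcreteCategory.congr_hom (congr_app (graph_snd X h x) h') a
  let a : h ⟶ h' := (pullback.snd (toPt X) (toPt (rep h))).app h' p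
  let y := (pullback.fst (toPt X) (toPt (rep h))).app h' p
  -- The only possible `x` is `y` carried back along `a`.
  refine ⟨⟨X.map (Groupoid.inv a) y, a⟩, ?_, ?_⟩
  · refine (H y a rfl).unique ⟨(h₁ _ a).trans ?_, h₂ _ a⟩ ⟨rfl, rfl⟩
    rw [← FintypeCat.comp_apply, ← X.map_comp]
    simp
  · rintro ⟨x, (b : h ⟶ h')⟩ hb
    dsimp only at hb
    have hba : b = a := (h₂ x b).symm.trans (congrArg _ hb)
    have hy : X.map b x = y := (h₁ x b).symm.trans (congrArg _ hb)
    rw [← hba, ← hy, ← FintypeCat.comp_apply, ← X.map_comp]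
    simp

end

/-- By pullback preservation, `(z, e)` is an element of `F` of the product; by coproduct
preservation, it comes from a unique `y` in one copy of `F (rep h)`, the one indexed by `x`. The
second projection forces `y = e`, and the first sends it to `F(x)(e)`. -/
theorem existsUnique_map_repHom (hp : PreservesLimitsOfShape WalkingCospan F)
    (hc : PreservesFiniteCoproducts F)
    {h : ℋ.carrier} {g : 𝒢.carrier} (e : ((F.obj (rep h)).obj g).obj)
    {X : ℋ.carrier ⥤ FintypeCat.{u}} (z : ((F.obj X).obj g).obj)
    (hz : (F.map (toPt X)).app g z = (F.map (toPt (rep h))).app g e) :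
    ∃! x : (X.obj h).obj, (F.map (repHom x)).app g e = z := by
  have H := (isPullback_iff_exists_unique _ _ _ _).1
    ((IsPullback.of_hasPullback (toPt X) (toPt (rep h))).map F)
  have H' := (nonempty_isColimit_cofan_iff _).1
    ⟨isColimitMapCoconeCofanMkEquiv F _ _ (isColimitOfPreserves F (isColimit_graph X h).some)⟩ g
  have h₁ (x : (X.obj h).obj) (y : ((F.obj (rep h)).obj g).obj) :
      (F.map (pullback.fst (toPt X) (toPt (rep h)))).app g ((F.map (graph X h x)).app g y) =
        (F.map (repHom x)).app g y := by
    rw [← FintypeCat.comp_apply, ← NatTrans.comp_app, ← F.map_comp, graph_fst]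
  have h₂ (x : (X.obj h).obj) (y : ((F.obj (rep h)).obj g).obj) :
      (F.map (pullback.snd (toPt X) (toPt (rep h)))).app g ((F.map (graph X h x)).app g y) =
        y := by
    rw [← FintypeCat.comp_apply, ← NatTrans.comp_app, ← F.map_comp, graph_snd]
    simp
  obtain ⟨w, ⟨hw₁, hw₂⟩, hw⟩ := H.2 g z e hz
  obtain ⟨⟨x, y⟩, hxy, hu⟩ := H' w
  dsimp only at hxy
  obtain rfl : y = e := by rw [← h₂ x y, hxy, hw₂]
  refine ⟨x, by rw [← hw₁, ← hxy, h₁], fun x' hx' => ?_⟩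
  have := hu ⟨x', y⟩ (hw _ ⟨(h₁ x' y).trans hx', h₂ x' y⟩)
  exact congrArg Sigma.fst this

/-- The coproduct of all representables covers the point, and it is finite since `ℋ` has finitely
many objects. Preservation of epimorphisms is used only here. -/
theorem exists_rep_elt (hc : PreservesFiniteCoproducts F) (he : F.PreservesEpimorphisms)
    {g : 𝒢.carrier} (t : ((F.obj ℋ.pt).obj g).obj) :
    ∃ (h : ℋ.carrier) (e : ((F.obj (rep h)).obj g).obj), (F.map (toPt (rep h))).app g e = t := by
  have h₁ : Epi (Sigma.desc fun h : ℋ.carrier => toPt (rep h)) := by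
    rw [epi_iff_surjective_app]
    intro h _
    exact ⟨(Sigma.ι (fun h : ℋ.carrier => rep h) h).app h (𝟙 h : h ⟶ h), rfl⟩
  obtain ⟨y, rfl⟩ := (epi_iff_surjective_app _).1
    (F.map_epi (Sigma.desc fun h : ℋ.carrier => toPt (rep h))) g t
  obtain ⟨⟨h, e⟩, rfl, -⟩ := (nonempty_isColimit_cofan_iff _).1
    ⟨isColimitMapCoconeCofanMkEquiv F _ _ (isColimitOfPreserves F
      (coproductIsCoproduct fun h : ℋ.carrier => rep h))⟩ g y
  refine ⟨h, e, ?_⟩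
  dsimp only
  rw [← FintypeCat.comp_apply, ← NatTrans.comp_app, ← F.map_comp, Sigma.ι_desc]

variable (hF : CatPCE.IsPCE ℋ.finCat 𝒢.finCat F)

/-- The object of `ℋ` over which a chosen element lies. -/
noncomputable def genPt (k : FinElements (F.obj ℋ.pt)) : ℋ.carrier :=
  (exists_rep_elt hF.2.1 hF.2.2 k.elt).choose

/-- A generic element over an element of the image of the point. -/
noncomputable def genElt (k : FinElements (F.obj ℋ.pt)) :
    ((F.obj (rep (genPt hF k))).obj k.base).obj :=
  (exists_rep_elt hF.2.1 hF.2.2 k.elt).choose_spec.choose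

theorem map_toPt_genElt (k : FinElements (F.obj ℋ.pt)) :
    (F.map (toPt (rep (genPt hF k)))).app k.base (genElt hF k) = k.elt :=
  (exists_rep_elt hF.2.1 hF.2.2 k.elt).choose_spec.choose_spec

theorem existsUnique_map_genElt (k : FinElements (F.obj ℋ.pt)) {X : ℋ.carrier ⥤ FintypeCat.{u}}
    (z : ((F.obj X).obj k.base).obj) (hz : (F.map (toPt X)).app k.base z = k.elt) :
    ∃! x : (X.obj (genPt hF k)).obj, (F.map (repHom x)).app k.base (genElt hF k) = z :=
  existsUnique_map_repHom hF.1 hF.2.1 _ z (hz.trans (map_toPt_genElt hF k).symm)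

theorem map_toPt_map_repHom_genElt (k : FinElements (F.obj ℋ.pt))
    {X : ℋ.carrier ⥤ FintypeCat.{u}} (x : (X.obj (genPt hF k)).obj) :
    (F.map (toPt X)).app k.base ((F.map (repHom x)).app k.base (genElt hF k)) = k.elt := by
  rw [← FintypeCat.comp_apply, ← NatTrans.comp_app, ← F.map_comp, hom_toPt, map_toPt_genElt]

/-- The generic element at `k`, transported along `a`, lies over `l.elt`, so genericity at `l`
expresses it through a unique element of `rep (genPt hF k)` at `genPt hF l`, which is a morphism. -/
theorem existsUnique_genHom {k l : FinElements (F.obj ℋ.pt)} (a : k ⟶ l) :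
    ∃! u : genPt hF k ⟶ genPt hF l,
      (F.map (repHom (X := rep (genPt hF k)) u)).app l.base (genElt hF l) =
        (F.obj (rep (genPt hF k))).map a.1 (genElt hF k) := by
  refine existsUnique_map_genElt hF l (X := rep (genPt hF k)) _ ?_
  rw [FunctorToFintypeCat.naturality, map_toPt_genElt]
  exact a.2

/-- The map between the chosen objects of `ℋ`. -/
noncomputable def genHom {k l : FinElements (F.obj ℋ.pt)} (a : k ⟶ l) :
    genPt hF k ⟶ genPt hF l :=
  (existsUnique_genHom hF a).choose

theorem map_genHom {k l : FinElements (F.obj ℋ.pt)} (a : k ⟶ l) :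
    (F.map (repHom (X := rep (genPt hF k)) (genHom hF a))).app l.base (genElt hF l) =
      (F.obj (rep (genPt hF k))).map a.1 (genElt hF k) :=
  (existsUnique_genHom hF a).choose_spec.1

/-- Extends the defining equation of `genHom` from the generic element to all of its images. It
yields both the functoriality of the right leg and the compatibility of the comparison with
transport. -/
theorem map_repHom_map_genHom {k l : FinElements (F.obj ℋ.pt)} (a : k ⟶ l)
    {X : ℋ.carrier ⥤ FintypeCat.{u}} (x : (X.obj (genPt hF k)).obj) :
    (F.map (repHom (X.map (genHom hF a) x))).app l.base (genElt hF l) =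
      (F.obj X).map a.1 ((F.map (repHom x)).app k.base (genElt hF k)) := by
  have h : repHom (X.map (genHom hF a) x) =
      repHom (X := rep (genPt hF k)) (genHom hF a) ≫ repHom x :=
    (repHom_comp (X := rep (genPt hF k)) (genHom hF a) (repHom x)).symm
  rw [h, F.map_comp, NatTrans.comp_app, FintypeCat.comp_apply, map_genHom,
    FunctorToFintypeCat.naturality]

theorem genHom_eq {k l : FinElements (F.obj ℋ.pt)} (a : k ⟶ l) {u : genPt hF k ⟶ genPt hF l}
    (hu : (F.map (repHom (X := rep (genPt hF k)) u)).app l.base (genElt hF l) =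
      (F.obj (rep (genPt hF k))).map a.1 (genElt hF k)) : genHom hF a = u :=
  (existsUnique_genHom hF a).unique (map_genHom hF a) hu

/-- The span attached to a functor that preserves pullbacks, finite coproducts and
epimorphisms. -/
noncomputable def span : BurnSpan 𝒢 ℋ where
  apex := { carrier := FinElements (F.obj ℋ.pt) }
  left := FinElements.proj _
  right :=
    { obj := genPt hF
      map := genHom hF
      map_id := fun k => genHom_eq hF (𝟙 k) (by
        rw [repHom_id, F.map_id]
        exact (ConcreteCategory.congr_hom ((F.obj _).map_id k.base) (genElt hF k)).symm)
      map_comp := fun {k l m} a b => genHom_eq hF (a ≫ b) (by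
        refine (map_repHom_map_genHom hF b (X := rep (genPt hF k)) (genHom hF a)).trans ?_
        rw [map_genHom]
        exact (ConcreteCategory.congr_hom ((F.obj _).map_comp a.1 b.1) (genElt hF k)).symm) }
  fib := FinElements.isDiscreteFibration_proj

open BurnSpan FibreElt

/-- The comparison map from the functor attached to the span. -/
noncomputable def comparison {X : ℋ.carrier ⥤ FintypeCat.{u}} {g : 𝒢.carrier}
    (x : FibreElt (span hF) X g) : ((F.obj X).obj g).obj :=
  (F.obj X).map (eqToHom x.eq) ((F.map (repHom x.val)).app _ (genElt hF x.pt))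

theorem comparison_mk {X : ℋ.carrier ⥤ FintypeCat.{u}} (k : FinElements (F.obj ℋ.pt))
    (x : (X.obj (genPt hF k)).obj) :
    comparison hF (⟨k, rfl, x⟩ : FibreElt (span hF) X k.base) =
      (F.map (repHom x)).app k.base (genElt hF k) :=
  ConcreteCategory.congr_hom ((F.obj X).map_id k.base) _

/-- The map to `F(pt)` splits `F(X)(g)` into fibres over the elements `t`, and genericity identifies
each fibre with `X` at the chosen object. For injectivity, the image in `F(pt)` first recovers `t`.
-/
theorem comparison_bijective (X : ℋ.carrier ⥤ FintypeCat.{u}) (g : 𝒢.carrier) :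
    Function.Bijective (comparison hF : FibreElt (span hF) X g → _) := by
  constructor
  · rintro ⟨⟨g, t⟩, rfl, x⟩ ⟨⟨g', t'⟩, (h' : g' = g), x'⟩ h
    subst h'
    have h₁ := (comparison_mk hF ⟨g', t⟩ x).symm.trans (h.trans (comparison_mk hF ⟨g', t'⟩ x'))
    obtain rfl : t = t' := (map_toPt_map_repHom_genElt hF ⟨g', t⟩ x).symm.trans
      ((congrArg _ h₁).trans (map_toPt_map_repHom_genElt hF ⟨g', t'⟩ x'))
    exact mk_inj_iff.2 ((existsUnique_map_genElt hF ⟨g', t⟩ _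
      (map_toPt_map_repHom_genElt hF _ x')).unique h₁ rfl)
  · intro z
    obtain ⟨x, hx, -⟩ := existsUnique_map_genElt hF ⟨g, (F.map (toPt X)).app g z⟩ z rfl
    exact ⟨⟨⟨g, (F.map (toPt X)).app g z⟩, rfl, x⟩, (comparison_mk hF _ x).trans hx⟩

/-- The morphism `f` lifts to the category of elements by pushing `k.elt` forward, so transport acts
on values through `genHom` of that lift. -/
theorem comparison_transport {X : ℋ.carrier ⥤ FintypeCat.{u}} {g g' : 𝒢.carrier} (f : g ⟶ g')
    (x : FibreElt (span hF) X g) :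
    comparison hF (transport f x) = (F.obj X).map f (comparison hF x) := by
  obtain ⟨k, rfl, x⟩ := x
  let l : FinElements (F.obj ℋ.pt) := ⟨g', (F.obj ℋ.pt).map f k.elt⟩
  let a : k ⟶ l := ⟨f, rfl⟩
  have h : transport f (⟨k, rfl, x⟩ : FibreElt (span hF) X k.base) =
      ⟨l, rfl, X.map (genHom hF a) x⟩ :=
    transport_eq (S := span hF) f a (show f = 𝟙 _ ≫ f ≫ 𝟙 _ by simp) rfl
  refine (congrArg (comparison hF) h).trans ((comparison_mk hF l _).trans ?_)
  exact (map_repHom_map_genHom hF a x).trans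
    (congrArg ((F.obj X).map f) (comparison_mk hF k x).symm)

theorem comparison_mapNat {X Y : ℋ.carrier ⥤ FintypeCat.{u}} (φ : X ⟶ Y) {g : 𝒢.carrier}
    (x : FibreElt (span hF) X g) :
    comparison hF (mapNat φ x) = (F.map φ).app g (comparison hF x) := by
  obtain ⟨k, rfl, x⟩ := x
  refine (comparison_mk hF k _).trans (Eq.trans ?_
    (congrArg ((F.map φ).app k.base) (comparison_mk hF k x).symm))
  change (F.map (repHom (φ.app _ x))).app k.base (genElt hF k) = _
  rw [← repHom_comp, F.map_comp]
  rfl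

/-- A functor that preserves pullbacks, finite coproducts and epimorphisms is isomorphic to the
functor attached to its span. -/
noncomputable def spanIso : functorOf (span hF) ≅ F :=
  NatIso.ofComponents (fun X => NatIso.ofComponents
    (fun g => FintypeCat.equivEquivIso (Equiv.ofBijective _ (comparison_bijective hF X g)))
    (fun {g g'} f => by
      ext (x : FibreElt (span hF) X g)
      exact comparison_transport hF f x)) (fun {X Y} φ => by
    ext g (x : FibreElt (span hF) X g)
    exact comparison_mapNat hF φ x)

end PCEFunctor

/-! ### The biequivalence -/

theorem isBiequivalence_finPseudofunctor : IsBiequivalence finPseudofunctor.{u} where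
  isEquivalence_mapFunctor a b :=
    { faithful := ⟨fun {f g η θ} h => congrArg Bicategory.Opposite.Hom2.op2'
        (natOf_injective (congrArg FinSub.natTrans h))⟩
      full := ⟨fun {f g} φ => ⟨Bicategory.Opposite.Hom2.op2'
        (homOfNat (S := f.unop) (T := g.unop) (FinSub.natTrans φ)),
        congrArg (fun z => InducedBicategory.Hom₂.mk (CatPCE.ofNat z))
          (natOf_homOfNat (S := f.unop) (T := g.unop) (FinSub.natTrans φ))⟩⟩
      essSurj := ⟨fun F => ⟨Quiver.Hom.op (V := BurnGlo.{u}) (X := b.unop) (Y := a.unop)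
        (PCEFunctor.span F.hom.property),
        ⟨InducedBicategory.isoMk (CatPCE.ofNatIso (PCEFunctor.spanIso F.hom.property))⟩⟩⟩ }
  essSurj := by
    rintro ⟨_, 𝒢, rfl⟩
    exact ⟨op ⟨𝒢⟩, ⟨Bicategory.Equivalence.id _⟩⟩

/-! ### Passage to the underlying (2,1)-categories -/

section Pith

universe w₁ w₂ v₁ v₂ u₁ u₂

variable {A : Type u₁} [Bicategory.{w₁, v₁} A] {B : Type u₂} [Bicategory.{w₂, v₂} B]

/-- The pseudofunctor between the underlying (2,1)-categories. -/
def CategoryTheory.Pseudofunctor.pithOp (F : Pseudofunctor Aᵒᵖ B) :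
    Pseudofunctor (Pith A)ᵒᵖ (Pith B) where
  obj a := ⟨F.obj (op a.unop.as)⟩
  map f := ⟨F.map f.unop.of.op⟩
  map₂ η := CoreHom.mk (F.map₂Iso (Iso.op2 (CoreHom.iso (Opposite.Hom2.unop2 η))))
  map₂_id _ := Pith.hom₂_ext _ (F.map₂_id _)
  map₂_comp η θ := Pith.hom₂_ext _ (F.map₂_comp
    (Bicategory.Opposite.op2 (CoreHom.iso (Opposite.Hom2.unop2 η)).hom)
    (Bicategory.Opposite.op2 (CoreHom.iso (Opposite.Hom2.unop2 θ)).hom))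
  mapId _ := Core.isoMk (F.mapId _)
  mapComp f g := Core.isoMk (F.mapComp f.unop.of.op g.unop.of.op)
  map₂_whisker_left f _ _ η := Pith.hom₂_ext _ (F.map₂_whisker_left f.unop.of.op
    (Bicategory.Opposite.op2 (CoreHom.iso (Opposite.Hom2.unop2 η)).hom))
  map₂_whisker_right η h := Pith.hom₂_ext _ (F.map₂_whisker_right
    (Bicategory.Opposite.op2 (CoreHom.iso (Opposite.Hom2.unop2 η)).hom) h.unop.of.op)
  map₂_associator f g h := Pith.hom₂_ext _ (F.map₂_associator f.unop.of.op g.unop.of.op h.unop.of.op)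
  map₂_left_unitor f := Pith.hom₂_ext _ (F.map₂_left_unitor f.unop.of.op)
  map₂_right_unitor f := Pith.hom₂_ext _ (F.map₂_right_unitor f.unop.of.op)

/-- An equivalence of hom-categories restricts to their cores, since a fully faithful functor lifts
isomorphisms to isomorphisms. An internal equivalence survives because its unit and counit are
invertible. -/
theorem IsBiequivalence.pithOp {F : Pseudofunctor Aᵒᵖ B} (hF : IsBiequivalence F) :
    IsBiequivalence F.pithOp where
  isEquivalence_mapFunctor a b := by
    let G := F.mapFunctor (op a.unop.as) (op b.unop.as)
    have : G.IsEquivalence := hF.isEquivalence_mapFunctor _ _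
    exact
      { faithful := ⟨fun {f g η θ} h => by
          have h' : Bicategory.Opposite.op2 (CoreHom.iso (Opposite.Hom2.unop2 η)).hom =
              Bicategory.Opposite.op2 (CoreHom.iso (Opposite.Hom2.unop2 θ)).hom :=
            G.map_injective (congrArg (fun z => (CoreHom.iso z).hom) h)
          exact congrArg Opposite.Hom2.op2'
            (Pith.hom₂_ext _ (congrArg Opposite.Hom2.unop2 h'))⟩
        full := ⟨fun {f g} φ =>
          ⟨Opposite.Hom2.op2' (CoreHom.mk (Iso.unop2 (G.preimageIso (CoreHom.iso φ)))),
            Pith.hom₂_ext _ (G.map_preimage _)⟩⟩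
        essSurj := ⟨fun f => ⟨Quiver.Hom.op ⟨(G.objPreimage f.of).unop⟩,
          ⟨Core.isoMk (G.objObjPreimageIso f.of)⟩⟩⟩ }
  essSurj b := by
    obtain ⟨a, ⟨e⟩⟩ := hF.essSurj b.as
    -- Adjusting the counit removes the need to recheck the triangle identity in the pith.
    exact ⟨op ⟨a.unop⟩, ⟨Equivalence.mkOfAdjointifyCounit (f := ⟨e.hom⟩) (g := ⟨e.inv⟩)
      (Core.isoMk e.unit) (Core.isoMk e.counit)⟩⟩

end Pith

theorem mainTheorem10 :
    AreBiequivalent BurnGlo.{u}ᵒᵖ FinSub.{u} ∧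
      AreBiequivalent (Bicategory.Pith BurnGlo.{u})ᵒᵖ (Bicategory.Pith FinSub.{u}) :=
  ⟨⟨_, isBiequivalence_finPseudofunctor⟩, ⟨_, isBiequivalence_finPseudofunctor.pithOp⟩⟩
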